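/- Let $B=(f_1,f_2,f_3)$ be the Borromean rings in $\mathbb R^3$, where $$f_1(x)=(0,2\cos x,\sin x),\qquad f_2(y)=(\cos y,0,2\sin y),\qquad f_3(z)=(2\cos z,\sin z,0)$$ for $x,y,z\in S^1$, and let $U=(f_1,e_2,f_3)$ with $e_2(y)=(\cos y,4,2\sin y)$. For $y\in S^1$ and $t\in[0,4]$ put $$H_1(y,t)=(\cos y,t,2\sin y),\qquad H_3(y,t)=(\cos y,t,2\sin y-(t-2)^2+4),$$ and let $G:S^1\times S^1\times[0,4]\times[0,1]\to\mathbb R^3\times\mathbb R^3$, $$G(y,z,t,s)=\bigl(f_3(z),\ sH_3(y,t)+(1-s)H_1(y,t)\bigr).$$ Let $\Delta\subset\mathbb R^3\times\mathbb R^3$ be the diagonal. (1) $G$, together with its restrictions to all boundary strata, is transverse to $\Delta$. The preimage $G^{-1}(\Delta)$ is a smoothly embedded arc, and each of the two projections to the $S^1$ factors restricts to a topological embedding of it. (2) A point of the second Taylor stage $\mathcal T_2\mathrm{Link}(S^1,S^1,S^1;\mathbb R^3)$ is modelled by three smooth maps $g_1,g_2,g_3:S^1\to\mathbb R^3$ together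 with, for each of the ordered pairs $(h,i)=(1,3),(3,2),(2,1)$, a homotopy $H_{hi}:S^1\times S^1\times[0,1]\to\mathbb R^3\times\mathbb R^3$ from $g_h\times g_i$ to a map that misses $\Delta$; a link map (that is, a triple of smooth maps with pairwise disjoint images) gives the point with constant homotopies. A path in this space, with time $u\in[0,a]$, has an obstruction manifold $Z$, which is glued from nine pieces. Let $(h,i,j)$ run through $(1,3,2),(3,2,1),(2,1,3)$ and let $x_1,x_2,x_3\in S^1$, $u\in[0,a]$. Suppress $u$ and write $p_1,p_2$ for the two projections of $\mathbb R^3\times\mathbb R^3$. The pieces are the preimages of $\Delta\times\Delta$ under $$\begin{aligned} \Phi_{hij}&=(H_{hi}(x_h,x_i,s),\,H_{ij}(x_i,x_j,t)), && 0\le s,t\le1,\\ \Phi_{1,(hi)j}&=(g_j(x_j),\,p_1H_{hi}(x_h,x_i,s),\,H_{hi}(x_h,x_i,t)), && 0\le s\le t\le 1,\\ \Phi_{2,(hi)j}&=(H_{hi}(x_h,x_i,s),\,p_2H_{hi}(x_h,x_i,t),\,g_j(x_j)), && 0\le t\le s\le1. \end{aligned}$$ Points with the same coordinates $(x_1,x_2,x_3,s,t,u)$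 are identified as follows: $\Phi_{hij}^{-1}$ with $\Phi_{2,(hi)j}^{-1}$ where $t=0$, $\Phi_{hij}^{-1}$ with $\Phi_{1,(ij)h}^{-1}$ where $s=0$, and $\Phi_{1,(hi)j}^{-1}$ with $\Phi_{2,(hi)j}^{-1}$ where $s=t$. The triples $B$ and $U$ are link maps, and $U$ is an unlink, that is, its components bound pairwise disjoint smoothly embedded disks. The components $(f_1,H_1(\cdot,u),f_3)$, $u\in[0,4]$, with the constant homotopies of $f_1\times f_3$ and of $H_1(\cdot,u)\times f_1$ for the pairs $(1,3)$ and $(2,1)$, and with the homotopy $(z,y,s)\mapsto G(y,z,u,s)$ for the pair $(3,2)$, form a smooth path in the second stage from the image of $B$ to the image of $U$. For this path all nine maps $\Phi$ and their restrictions to all boundary strata are transverse to $\Delta\times\Delta$, and the obstruction manifold $Z$ is a single point. (3) $B$ is not link homotopic to $U$, nor to any other unlink of three components: no continuous homotopy of the three components from $B$ to an unlink keeps the images of different components disjoint at all times. -/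

import Mathlib

open Set
open scoped ContDiff

namespace BorromeanRings

/-- Euclidean three-space. -/
abbrev E3 : Type := EuclideanSpace ℝ (Fin 3)

/-! ### Link maps of three circles in three-space

The circle is the unit circle `Circle` in `ℂ`; the point with angle `θ` is `Circle.exp θ`, and
its cosine and sine are its real and imaginary parts.  Smoothness of, and derivatives along, maps
out of circles are taken in the angle coordinates given by the local diffeomorphism
`Circle.exp : ℝ → Circle`. -/

/-- Three maps of a circle have pairwise disjoint images. -/
def DisjointImages (f : Fin 3 → Circle → E3) : Prop :=
  Pairwise fun i j => Disjoint (range (f i)) (range (f j))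

/-- A link map: three smooth maps of a circle with pairwise disjoint images. -/
def IsLinkMap (f : Fin 3 → Circle → E3) : Prop :=
  (∀ i, ContDiff ℝ ∞ fun θ : ℝ => f i (Circle.exp θ)) ∧ DisjointImages f

/-- `f` and `g` are link homotopic: they are joined by a homotopy of the three components during
which the images of different components stay disjoint at all times.  (The homotopy is only asked
to be continuous, so the negation also excludes smooth link homotopies.) -/
def LinkHomotopic (f g : Fin 3 → Circle → E3) : Prop :=
  ∃ h : Fin 3 → unitInterval → Circle → E3,
    (∀ i, Continuous fun p : unitInterval × Circle => h i p.1 p.2) ∧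
    (∀ τ, DisjointImages fun i => h i τ) ∧
    (∀ i, h i 0 = f i) ∧ (∀ i, h i 1 = g i)

/-- An unlink of three components: the components bound pairwise disjoint smoothly embedded
closed disks. -/
def IsUnlink (f : Fin 3 → Circle → E3) : Prop :=
  ∃ D : Fin 3 → ℂ → E3,
    (∀ i, ContDiff ℝ ∞ (D i)) ∧
    (∀ i, InjOn (D i) (Metric.closedBall 0 1)) ∧
    (∀ i, ∀ w ∈ Metric.closedBall (0 : ℂ) 1, Function.Injective (fderiv ℝ (D i) w)) ∧
    (∀ i (z : Circle), D i (z : ℂ) = f i z) ∧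
    Pairwise fun i j =>
      Disjoint (D i '' Metric.closedBall 0 1) (D j '' Metric.closedBall 0 1)

/-! ### Transversality on domains with corners -/

/-- The diagonal of `ℝ³ × ℝ³`. -/
def diag : Submodule ℝ (E3 × E3) :=
  LinearMap.eqLocus (LinearMap.fst ℝ E3 E3) (LinearMap.snd ℝ E3 E3)

/-- The directions tangent at `p` to the smallest stratum (open face) of the convex polyhedron `K`
through `p`: those in which one can move a little both ways inside `K`. -/
def stratumDirections {V : Type*} [NormedAddCommGroup V] [NormedSpace ℝ V]
    (K : Set V) (p : V) : Submodule ℝ V :=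
  Submodule.span ℝ {v | ∃ ε > 0, ∀ r : ℝ, |r| < ε → p + r • v ∈ K}

/-- The map `Φ`, on the convex polyhedron `K`, is transverse to the linear subspace `S`, and so are
its restrictions to all strata of `K`.  (Transversality on the smallest stratum through a point is
the strongest of these conditions at that point.) -/
def TransverseOn {V W : Type*} [NormedAddCommGroup V] [NormedSpace ℝ V]
    [NormedAddCommGroup W] [NormedSpace ℝ W]
    (K : Set V) (Φ : V → W) (S : Submodule ℝ W) : Prop :=
  ∀ p ∈ K, Φ p ∈ S →
    Submodule.map (fderiv ℝ Φ p : V →ₗ[ℝ] W) (stratumDirections K p) ⊔ S = ⊤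

/-! ### Paths in the second Taylor stage of the space of link maps

A point of the second stage is a triple of maps `f i : S¹ → ℝ³` together with, for each pair of
components, a homotopy `H` of maps `S¹ × S¹ → ℝ³ × ℝ³` from the product of the two components to a
map that misses the diagonal.  The components are indexed by `Fin 3`, and the three pairs are taken
in the cyclic order `(h, h + 2)`, that is `(0, 2), (2, 1), (1, 0)`. -/

/-- The data of a path in the second stage: `f i x u` is the `i`-th component at path time `u`, and
`H h x y s u` is the homotopy (with parameter `s`) for the pair `(h, h + 2)` at path time `u`. -/
structure PathData where
  f : Fin 3 → Circle → ℝ → E3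
  H : Fin 3 → Circle → Circle → ℝ → ℝ → E3 × E3

/-- `L` is a smooth path, parametrized by `[0, a]`, in the second stage. -/
def IsStagePath (a : ℝ) (L : PathData) : Prop :=
  (∀ i, ContDiff ℝ ∞ fun p : ℝ × ℝ => L.f i (Circle.exp p.1) p.2) ∧
  (∀ h, ContDiff ℝ ∞ fun p : ℝ × ℝ × ℝ × ℝ =>
    L.H h (Circle.exp p.1) (Circle.exp p.2.1) p.2.2.1 p.2.2.2) ∧
  (∀ h x y, ∀ u ∈ Icc 0 a, L.H h x y 0 u = (L.f h x u, L.f (h + 2) y u)) ∧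
  (∀ h x y, ∀ u ∈ Icc 0 a, L.H h x y 1 u ∉ diag)

/-- At time `u` the path `L` is at the image of the link map `f` in the second stage: the components
are those of `f` and the homotopies are constant. -/
def AtLinkMap (L : PathData) (u : ℝ) (f : Fin 3 → Circle → E3) : Prop :=
  (∀ i x, L.f i x u = f i x) ∧
  (∀ h x y, ∀ s ∈ Icc (0 : ℝ) 1, L.H h x y s u = (f h x, f (h + 2) y))

/-! ### The obstruction manifold of a path

Write `i = h + 2` and `j = h + 1`, so that `(h, i, j)` runs through the cyclic orderings and the
pairs `(h, i)` and `(i, j)` are among the three chosen ones. -/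

/-- Labels of the nine pieces of the obstruction manifold: the intersections `circles h` of the
Whitney circles of the pairs `(h, i)` and `(i, j)`, and the intersections `disk₁ h`, `disk₂ h` of
the `j`-th component with the two halves of the Whitney disk of the pair `(h, i)`. -/
inductive Piece : Type
  | circles (h : Fin 3)
  | disk₁ (h : Fin 3)
  | disk₂ (h : Fin 3)

/-- The points `(x, s, t, u)`: one point on each circle, two homotopy parameters, a path time. -/
abbrev Param : Type := (Fin 3 → Circle) × ℝ × ℝ × ℝ

/-- The domain of the parameters `(s, t, u)` for each piece. -/
def paramDomain (a : ℝ) : Piece → Set (ℝ × ℝ × ℝ)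
  | .circles _ => {q | q.1 ∈ Icc 0 1 ∧ q.2.1 ∈ Icc 0 1 ∧ q.2.2 ∈ Icc 0 a}
  | .disk₁ _ => {q | (0 ≤ q.1 ∧ q.1 ≤ q.2.1 ∧ q.2.1 ≤ 1) ∧ q.2.2 ∈ Icc 0 a}
  | .disk₂ _ => {q | (0 ≤ q.2.1 ∧ q.2.1 ≤ q.1 ∧ q.1 ≤ 1) ∧ q.2.2 ∈ Icc 0 a}

/-- The maps to `(ℝ³)⁴` that define the pieces. -/
def pieceMap (L : PathData) : Piece → Param → (E3 × E3) × (E3 × E3)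
  | .circles h, (x, s, t, u) =>
      (L.H h (x h) (x (h + 2)) s u, L.H (h + 2) (x (h + 2)) (x (h + 1)) t u)
  | .disk₁ h, (x, s, t, u) =>
      ((L.f (h + 1) (x (h + 1)) u, (L.H h (x h) (x (h + 2)) s u).1),
        L.H h (x h) (x (h + 2)) t u)
  | .disk₂ h, (x, s, t, u) =>
      (L.H h (x h) (x (h + 2)) s u,
        ((L.H h (x h) (x (h + 2)) t u).2, L.f (h + 1) (x (h + 1)) u))

/-- A piece is the preimage of the product of two diagonals. -/
def pieceSet (a : ℝ) (L : PathData) (k : Piece) : Set Param :=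
  {p | p.2 ∈ paramDomain a k ∧ pieceMap L k p ∈ diag.prod diag}

/-- All maps defining pieces, and their restrictions to all strata, are transverse. -/
def IsTransversePath (a : ℝ) (L : PathData) : Prop :=
  ∀ k, TransverseOn {p : (Fin 3 → ℝ) × ℝ × ℝ × ℝ | p.2 ∈ paramDomain a k}
    (fun p => pieceMap L k (fun i => Circle.exp (p.1 i), p.2)) (diag.prod diag)

/-- The identifications of boundary parts of the pieces. -/
inductive Glue (a : ℝ) (L : PathData) :
    (Σ k, pieceSet a L k) → (Σ k, pieceSet a L k) → Prop
  | t_zero (h : Fin 3) (p : Param) (h₁ : p ∈ pieceSet a L (.circles h))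
      (h₂ : p ∈ pieceSet a L (.disk₂ h)) (ht : p.2.2.1 = 0) :
      Glue a L ⟨.circles h, p, h₁⟩ ⟨.disk₂ h, p, h₂⟩
  | s_zero (h : Fin 3) (p : Param) (h₁ : p ∈ pieceSet a L (.circles h))
      (h₂ : p ∈ pieceSet a L (.disk₁ (h + 2))) (hs : p.2.1 = 0) :
      Glue a L ⟨.circles h, p, h₁⟩ ⟨.disk₁ (h + 2), p, h₂⟩
  | s_eq_t (h : Fin 3) (p : Param) (h₁ : p ∈ pieceSet a L (.disk₁ h))
      (h₂ : p ∈ pieceSet a L (.disk₂ h)) (hst : p.2.1 = p.2.2.1) :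
      Glue a L ⟨.disk₁ h, p, h₁⟩ ⟨.disk₂ h, p, h₂⟩

/-- The obstruction manifold of a path: the nine pieces glued along their boundaries. -/
def ObstructionManifold (a : ℝ) (L : PathData) : Type :=
  Quot (Glue a L)

/-! ### The example -/

/-- `f₁(x) = (0, 2 cos x, sin x)`. -/
noncomputable def f₁ (x : Circle) : E3 := !₂[0, 2 * (x : ℂ).re, (x : ℂ).im]

/-- `f₂(y) = (cos y, 0, 2 sin y)`. -/
noncomputable def f₂ (y : Circle) : E3 := !₂[(y : ℂ).re, 0, 2 * (y : ℂ).im]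

/-- `f₃(z) = (2 cos z, sin z, 0)`. -/
noncomputable def f₃ (z : Circle) : E3 := !₂[2 * (z : ℂ).re, (z : ℂ).im, 0]

/-- `e₂(y) = (cos y, 4, 2 sin y)`. -/
noncomputable def e₂ (y : Circle) : E3 := !₂[(y : ℂ).re, 4, 2 * (y : ℂ).im]

/-- The Borromean rings. -/
noncomputable def borromean : Fin 3 → Circle → E3 := ![f₁, f₂, f₃]

/-- The unlink. -/
noncomputable def unlink : Fin 3 → Circle → E3 := ![f₁, e₂, f₃]

/-- `H₁(y, t) = (cos y, t, 2 sin y)`. -/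
noncomputable def H₁ (y : Circle) (t : ℝ) : E3 := !₂[(y : ℂ).re, t, 2 * (y : ℂ).im]

/-- `H₃(y, t) = (cos y, t, 2 sin y - (t - 2)² + 4)`. -/
noncomputable def H₃ (y : Circle) (t : ℝ) : E3 :=
  !₂[(y : ℂ).re, t, 2 * (y : ℂ).im - (t - 2) ^ 2 + 4]

/-- `G(y, z, t, s) = (f₃(z), s H₃(y, t) + (1 - s) H₁(y, t))`. -/
noncomputable def G (y z : Circle) (t s : ℝ) : E3 × E3 :=
  (f₃ z, s • H₃ y t + (1 - s) • H₁ y t)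

/-- The preimage of the diagonal under `G` in `S¹ × S¹ × [0, 4] × [0, 1]`. -/
def preimageG : Set (Circle × Circle × ℝ × ℝ) :=
  {q | q.2.2.1 ∈ Icc 0 4 ∧ q.2.2.2 ∈ Icc 0 1 ∧ G q.1 q.2.1 q.2.2.1 q.2.2.2 ∈ diag}

/-- A smoothly embedded arc in `S¹ × S¹ × ℝ × ℝ`. -/
def IsSmoothArc (A : Set (Circle × Circle × ℝ × ℝ)) : Prop :=
  ∃ γ : ℝ → ℝ × ℝ × ℝ × ℝ, ContDiff ℝ ∞ γ ∧ (∀ r ∈ Icc (0 : ℝ) 1, deriv γ r ≠ 0) ∧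
    InjOn (fun r => (Circle.exp (γ r).1, Circle.exp (γ r).2.1, (γ r).2.2)) (Icc 0 1) ∧
    (fun r => (Circle.exp (γ r).1, Circle.exp (γ r).2.1, (γ r).2.2)) '' Icc 0 1 = A

/-- The path in the second stage: the components are `(f₁, H₁(·, u), f₃)`, the homotopies for the
pairs (first, third) and (second, first) are constant, the one for (third, second) is `G`. -/
noncomputable def liftedPath : PathData where
  f := ![fun x _ => f₁ x, fun y u => H₁ y u, fun z _ => f₃ z]
  H := ![fun x z _ _ => (f₁ x, f₃ z), fun y x _ u => (H₁ y u, f₁ x), fun z y s u => G y z u s]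

end BorromeanRings

open BorromeanRings

/-!
The three differences of the components of a link map of three circles sum to zero, so they never
all point in the same direction. Suppose that over the three-torus they are lifted continuously to
spinors, that is, to eigenvectors of the corresponding Pauli matrices. The area form of two spinors
vanishes only if their directions agree, so the area forms of the first two and of the last two
spinors give a map of the torus to `ℂ² ∖ 0`. A link homotopy carries the lift along and changes this
map by a homotopy only.

For an unlink the map is homotopic to a constant, since each component shrinks to a point within its
disk. For the Borromean rings the differences deform to a triple of great circles, with explicit
spinors. The map they define is not homotopic to a constant: the pullback of a three-form supported
near a ray, closed away from the origin, is a density of constant sign that is not identically zero.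

A point of `G⁻¹(Δ)` satisfies `2 cos z = cos y` and `sin z = t`, and these equations determine `z`,
`t` and then `s` from `y`. Of the nine pieces of the obstruction manifold only one meets the
diagonal, in a single point, since the other two homotopies are constant. Transversality is checked
by solving for the preimages of a basis in terms of the derivatives along coordinate lines.
-/

namespace BorromeanRings

section PeriodIntegral

open MeasureTheory

variable {E : Type*} [NormedAddCommGroup E] [NormedSpace ℝ E] {n : ℕ}

/-- The integral of the pullback of an `n`-form under a map that is `2π`-periodic in each of its
`n` variables, over one period. -/
noncomputable def periodIntegral (α : E → E [⋀^Fin n]→L[ℝ] ℝ) (f : (Fin n → ℝ) → E) : ℝ :=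
  ∫ x in Icc 0 fun _ => 2 * Real.pi, α (f x) fun j => fderiv ℝ f x (Pi.single j 1)

theorem periodIntegral_const (α : E → E [⋀^Fin (n + 1)]→L[ℝ] ℝ) (c : E) :
    periodIntegral α (fun _ => c) = 0 := by
  have (x : Fin (n + 1) → ℝ) :
      α c (fun j => fderiv ℝ (fun _ : Fin (n + 1) → ℝ => c) x (Pi.single j 1)) = 0 :=
    (α c).map_coord_zero 0 (by simp)
  simp only [periodIntegral, this, integral_zero]

theorem insertNth_eq_insertNth_zero_add_single {n : ℕ} (i : Fin (n + 1)) (t : ℝ) (x : Fin n → ℝ) :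
    (i.insertNth t x : Fin (n + 1) → ℝ) = i.insertNth 0 x + Pi.single i t := by
  refine Fin.insertNth_eq_iff.2 ⟨by simp, funext fun k => ?_⟩
  simp [Fin.removeNth]

theorem sum_fderiv_succAbove_eq_extDeriv {n : ℕ}
    {η : (Fin (n + 1) → ℝ) → (Fin (n + 1) → ℝ) [⋀^Fin n]→L[ℝ] ℝ} (hη : Differentiable ℝ η)
    (x : Fin (n + 1) → ℝ) :
    ∑ i : Fin (n + 1),
        fderiv ℝ (fun y => (-1) ^ (i : ℕ) * η y fun j => Pi.single (i.succAbove j) 1) x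
          (Pi.single i 1) =
      extDeriv η x fun j => Pi.single j 1 := by
  rw [extDeriv_apply (hη x)]
  refine Finset.sum_congr rfl fun i _ => ?_
  rw [fderiv_const_mul (hη.continuousAlternatingMap_apply (fun _ => differentiable_const _) x)]
  simp only [smul_apply, smul_eq_mul, zsmul_eq_mul, Int.cast_pow, Int.cast_neg, Int.cast_one]
  rfl

theorem integral_slice_eq_of_extDeriv_eq_zero {n : ℕ}
    {η : (Fin (n + 1) → ℝ) → (Fin (n + 1) → ℝ) [⋀^Fin n]→L[ℝ] ℝ} (hη : Differentiable ℝ η)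
    {T : Fin n → ℝ} (hT : 0 ≤ T) (hper : ∀ j : Fin n, Function.Periodic η (Pi.single j.succ (T j)))
    {a b : ℝ} (hab : a ≤ b) (hclosed : ∀ x, x 0 ∈ Icc a b → extDeriv η x = 0) :
    ∫ x in Icc 0 T, η (Fin.cons a x) (fun j => Pi.single j.succ 1) =
      ∫ x in Icc 0 T, η (Fin.cons b x) (fun j => Pi.single j.succ 1) := by
  let g : Fin (n + 1) → (Fin (n + 1) → ℝ) → ℝ := fun i x =>
    (-1) ^ (i : ℕ) * η x fun j => Pi.single (i.succAbove j) 1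
  have hg (i : Fin (n + 1)) : Differentiable ℝ (g i) :=
    (hη.continuousAlternatingMap_apply fun _ => differentiable_const _).const_mul _
  have hdiv (x : Fin (n + 1) → ℝ) (hx : x 0 ∈ Icc a b) :
      ∑ i, fderiv ℝ (g i) x (Pi.single i 1) = 0 := by
    rw [sum_fderiv_succAbove_eq_extDeriv hη, hclosed x hx]
    rfl
  let lo : Fin (n + 1) → ℝ := Fin.cons a 0
  let hi : Fin (n + 1) → ℝ := Fin.cons b T
  have hle : lo ≤ hi := Fin.cons_le_cons.2 ⟨hab, hT⟩
  have hmem (x : Fin (n + 1) → ℝ) (hx : x ∈ Icc lo hi) : x 0 ∈ Icc a b := ⟨hx.1 0, hx.2 0⟩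
  have hint : IntegrableOn (fun x => ∑ i, fderiv ℝ (g i) x (Pi.single i 1)) (Icc lo hi) :=
    integrableOn_zero.congr_fun (fun x hx => (hdiv x (hmem x hx)).symm) measurableSet_Icc
  have hstokes := integral_divergence_of_hasFDerivAt_off_countable' lo hi hle g
    (fun i => fderiv ℝ (g i)) ∅ countable_empty (fun i => (hg i).continuous.continuousOn)
    (fun x _ i => (hg i x).hasFDerivAt) hint
  have hside (j : Fin n) (x : Fin n → ℝ) :
      g j.succ (j.succ.insertNth (hi j.succ) x) = g j.succ (j.succ.insertNth (lo j.succ) x) := by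
    simp only [g, hi, lo, Fin.cons_succ, Pi.zero_apply,
      insertNth_eq_insertNth_zero_add_single _ (T j), hper j _]
  have hbottom (t : ℝ) (x : Fin n → ℝ) :
      g 0 (Fin.insertNth 0 t x) = η (Fin.cons t x) fun j => Pi.single j.succ 1 := by
    simp only [g, Fin.insertNth_zero', Fin.val_zero, pow_zero, one_mul]
    rfl
  rw [setIntegral_congr_fun measurableSet_Icc fun x hx => hdiv x (hmem x hx), integral_zero,
    Fin.sum_univ_succ] at hstokes
  simp only [hside, sub_self, Finset.sum_const_zero, add_zero, hbottom] at hstokes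
  exact (sub_eq_zero.1 hstokes.symm).symm

theorem fderiv_periodic {F : Type*} [NormedAddCommGroup F] [NormedSpace ℝ F] {f : F → E} {c : F}
    (h : Function.Periodic f c) : Function.Periodic (fderiv ℝ f) c := fun x => by
  rw [← fderiv_comp_add_right, h.funext]

theorem fderiv_comp_cons_single {F : (Fin (n + 1) → ℝ) → E} (hF : Differentiable ℝ F) (t : ℝ)
    (x : Fin n → ℝ) (j : Fin n) :
    fderiv ℝ (fun y : Fin n → ℝ => F (Fin.cons t y)) x (Pi.single j 1) =
      fderiv ℝ F (Fin.cons t x) (Pi.single j.succ 1) := by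
  have hcons : HasFDerivAt (fun y : Fin n → ℝ => (Fin.cons t y : Fin (n + 1) → ℝ))
      ((0 : (Fin n → ℝ) →L[ℝ] ℝ).finCons (.id ℝ _)) x :=
    (hasFDerivAt_const t x).finCons (hasFDerivAt_id x)
  have hsingle : (Fin.cons 0 (Pi.single j 1) : Fin (n + 1) → ℝ) = Pi.single j.succ 1 :=
    funext fun i => by cases i using Fin.cases <;> simp [Pi.single_apply]
  rw [HasFDerivAt.fderiv (f := fun y => F (Fin.cons t y)) ((hF _).hasFDerivAt.comp x hcons),
    ← hsingle]
  rfl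

theorem periodIntegral_slice_eq {α : E → E [⋀^Fin n]→L[ℝ] ℝ} (hα : Differentiable ℝ α)
    {F : (Fin (n + 1) → ℝ) → E} (hF : ContDiff ℝ 2 F)
    (hper : ∀ j : Fin n, Function.Periodic F (Pi.single j.succ (2 * Real.pi)))
    {a b : ℝ} (hab : a ≤ b) (hclosed : ∀ x, x 0 ∈ Icc a b → extDeriv α (F x) = 0) :
    periodIntegral α (fun x => F (Fin.cons a x)) =
      periodIntegral α (fun x => F (Fin.cons b x)) := by
  have hF' : Differentiable ℝ F := hF.differentiable two_ne_zero
  have hη : Differentiable ℝ fun x => (α (F x)).compContinuousLinearMap (fderiv ℝ F x) := fun x =>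
    (hα.comp hF' x).continuousAlternatingMapCompContinuousLinearMap
      ((hF.fderiv_right le_rfl).differentiable one_ne_zero x)
  have hper' (j : Fin n) : Function.Periodic
      (fun x => (α (F x)).compContinuousLinearMap (fderiv ℝ F x))
      (Pi.single j.succ (2 * Real.pi)) := fun x => by
    simp only [hper j x, fderiv_periodic (hper j) x]
  have hclosed' (x : Fin (n + 1) → ℝ) (hx : x 0 ∈ Icc a b) :
      extDeriv (fun x => (α (F x)).compContinuousLinearMap (fderiv ℝ F x)) x = 0 := by
    rw [extDeriv_pullback (hα (F x)) hF.contDiffAt (by simp), hclosed x hx]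
    rfl
  have hslice := integral_slice_eq_of_extDeriv_eq_zero hη (T := fun _ => 2 * Real.pi)
    (fun _ => Real.two_pi_pos.le) hper' hab hclosed'
  simpa only [periodIntegral, fderiv_comp_cons_single hF',
    ContinuousAlternatingMap.compContinuousLinearMap_apply, Function.comp_def] using hslice

end PeriodIntegral

section RayForm

open Topology

variable {n : ℕ}

theorem eq_zero_of_finrank_lt {V : Type*} [NormedAddCommGroup V] [NormedSpace ℝ V]
    [FiniteDimensional ℝ V] {m : ℕ} (h : Module.finrank ℝ V < m) (β : V [⋀^Fin m]→L[ℝ] ℝ) :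
    β = 0 := by
  ext v
  refine β.toAlternatingMap.map_linearDependent v fun hv => h.not_ge ?_
  simpa using hv.fintype_card_le_finrank

/-- The standard volume form on `ℝⁿ`. -/
noncomputable def volumeForm (n : ℕ) : (Fin n → ℝ) [⋀^Fin n]→L[ℝ] ℝ :=
  { Matrix.detRowAlternating with cont := continuous_id.matrix_det }

/-- A bump form on `ℝⁿ`, cut off smoothly on `ℝ × ℝⁿ` so that it lives near the negative half-axis
of the first factor. It is closed away from the origin, and the integral of its pullback counts the
crossings of a map through that half-axis. -/
noncomputable def rayForm (ρ : ContDiffBump (0 : Fin n → ℝ)) (c : ℝ × (Fin n → ℝ)) :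
    (ℝ × (Fin n → ℝ)) [⋀^Fin n]→L[ℝ] ℝ :=
  (Real.smoothTransition (-c.1 / ρ.rOut) * ρ c.2) •
    (volumeForm n).compContinuousLinearMap (.snd ℝ ℝ _)

theorem contDiff_rayForm (ρ : ContDiffBump (0 : Fin n → ℝ)) : ContDiff ℝ ∞ (rayForm ρ) :=
  ((Real.smoothTransition.contDiff.comp (contDiff_fst.neg.div_const _)).mul
    (ρ.contDiff.comp contDiff_snd)).smul contDiff_const

theorem extDeriv_bump_smul_volumeForm_snd (ρ : ContDiffBump (0 : Fin n → ℝ)) (k : ℝ)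
    (c : ℝ × (Fin n → ℝ)) :
    extDeriv (fun c : ℝ × (Fin n → ℝ) =>
      (k * ρ c.2) • (volumeForm n).compContinuousLinearMap (.snd ℝ ℝ _)) c = 0 := by
  have hβ : DifferentiableAt ℝ (fun q => (k * ρ q) • volumeForm n) c.2 :=
    ((contDiff_const.mul ρ.contDiff).smul contDiff_const).differentiable one_ne_zero _
  have h := extDeriv_pullback (r := 2) hβ contDiff_snd.contDiffAt (by simp)
  rw [eq_zero_of_finrank_lt (by simp) (extDeriv _ c.2)] at h
  simp only [fderiv_snd] at h
  exact h

theorem smoothTransition_div_eventuallyEq_const {r t : ℝ} (hr : 0 < r) (ht : r < |t|) :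
    ∃ k, (fun s => Real.smoothTransition (-s / r)) =ᶠ[𝓝 t] fun _ => k := by
  rcases lt_abs.1 ht with h | h
  · refine ⟨0, ?_⟩
    filter_upwards [lt_mem_nhds (hr.trans h)] with s hs
    exact Real.smoothTransition.zero_of_nonpos
      (div_nonpos_of_nonpos_of_nonneg (neg_nonpos.2 hs.le) hr.le)
  · refine ⟨1, ?_⟩
    filter_upwards [gt_mem_nhds (lt_neg_of_lt_neg h)] with s hs
    exact Real.smoothTransition.one_of_one_le ((one_le_div hr).2 (le_neg_of_le_neg hs.le))

theorem extDeriv_rayForm (ρ : ContDiffBump (0 : Fin n → ℝ)) {c : ℝ × (Fin n → ℝ)}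
    (hc : ρ.rOut < ‖c‖) : extDeriv (rayForm ρ) c = 0 := by
  suffices h : ∃ k : ℝ, rayForm ρ =ᶠ[𝓝 c] fun c =>
      (k * ρ c.2) • (volumeForm n).compContinuousLinearMap (.snd ℝ ℝ _) by
    obtain ⟨k, hk⟩ := h
    rw [hk.extDeriv_eq, extDeriv_bump_smul_volumeForm_snd]
  rcases lt_sup_iff.1 (Prod.norm_def c ▸ hc) with h | h
  · obtain ⟨k, hk⟩ := smoothTransition_div_eventuallyEq_const ρ.rOut_pos h
    refine ⟨k, (continuousAt_fst.eventually hk).mono fun b hb => ?_⟩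
    simp only [rayForm, hb]
  · refine ⟨0, (continuous_snd.norm.continuousAt.eventually_const_lt h).mono fun b hb => ?_⟩
    have hb' : ρ b.2 = 0 := ρ.zero_of_le_dist (by simpa using hb.le)
    simp only [rayForm, hb', mul_zero]

end RayForm

section SmoothHomotopy

open scoped Manifold Topology

/-- The nonzero vectors of a vector space. -/
abbrev Punctured (F : Type*) [Zero F] : Type _ := {w : F // w ≠ 0}

variable {E F H M : Type*} [NormedAddCommGroup E] [NormedSpace ℝ E] [FiniteDimensional ℝ E]
  [NormedAddCommGroup F] [NormedSpace ℝ F] [TopologicalSpace H] (I : ModelWithCorners ℝ E H)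
  [TopologicalSpace M] [ChartedSpace H M] [IsManifold I ∞ M] [CompactSpace M] [T2Space M]

theorem exists_contMDiff_homotopy_norm_ge {g₀ g₁ : C(M, Punctured F)}
    (h₀ : ContMDiff I 𝓘(ℝ, F) ∞ fun x => (g₀ x : F))
    (h₁ : ContMDiff I 𝓘(ℝ, F) ∞ fun x => (g₁ x : F)) (hom : g₀.Homotopic g₁) :
    ∃ g : M × ℝ → F, ContMDiff (I.prod 𝓘(ℝ, ℝ)) 𝓘(ℝ, F) ∞ g ∧ (∃ δ > 0, ∀ p, δ ≤ ‖g p‖) ∧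
      (∀ x, g (x, -1) = g₀ x) ∧ ∀ x, g (x, 2) = g₁ x := by
  obtain ⟨K⟩ := hom
  obtain ⟨δ, hδ, hKδ⟩ : ∃ δ > 0, ∀ p, δ ≤ ‖(K p : F)‖ := by
    have hc : Continuous fun p => ‖(K p : F)‖ := (continuous_subtype_val.comp K.continuous).norm
    simpa using isCompact_univ.exists_forall_le' hc.continuousOn (a := 0)
      fun p _ => norm_pos_iff.2 (K p).2
  let f : M × ℝ → F := fun p => K (projIcc 0 1 zero_le_one p.2, p.1)
  have hf : Continuous f := by fun_prop
  have hf₀ (p : M × ℝ) (hp : p.2 ≤ 0) : f p = g₀ p.1 := by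
    simp only [f, projIcc_of_le_left _ hp]
    exact congrArg Subtype.val (K.apply_zero p.1)
  have hf₁ (p : M × ℝ) (hp : 1 ≤ p.2) : f p = g₁ p.1 := by
    simp only [f, projIcc_of_right_le _ hp]
    exact congrArg Subtype.val (K.apply_one p.1)
  have hU₀ : IsOpen {p : M × ℝ | p.2 < 0} := isOpen_lt continuous_snd continuous_const
  have hU₁ : IsOpen {p : M × ℝ | 1 < p.2} := isOpen_lt continuous_const continuous_snd
  have hfU : ContMDiffOn (I.prod 𝓘(ℝ, ℝ)) 𝓘(ℝ, F) ∞ f ({p | p.2 < 0} ∪ {p | 1 < p.2}) :=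
    ((h₀.comp contMDiff_fst).contMDiffOn.congr fun p hp => hf₀ p (le_of_lt hp)).union_of_isOpen
      ((h₁.comp contMDiff_fst).contMDiffOn.congr fun p hp => hf₁ p (le_of_lt hp)) hU₀ hU₁
  have hS : IsClosed ({p : M × ℝ | p.2 ≤ -1} ∪ {p | 2 ≤ p.2}) :=
    (isClosed_le continuous_snd continuous_const).union
      (isClosed_le continuous_const continuous_snd)
  have hSU : {p : M × ℝ | p.2 < 0} ∪ {p | 1 < p.2} ∈ 𝓝ˢ ({p : M × ℝ | p.2 ≤ -1} ∪ {p | 2 ≤ p.2}) :=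
    (hU₀.union hU₁).mem_nhdsSet.2 <| union_subset_union
      (fun p (hp : p.2 ≤ -1) => show p.2 < 0 by linarith)
      (fun p (hp : 2 ≤ p.2) => show 1 < p.2 by linarith)
  obtain ⟨g, hg, hgS, -⟩ := hf.exists_contMDiff_approx_and_eqOn (I.prod 𝓘(ℝ, ℝ)) ⊤
    (ε := fun _ => δ / 2) continuous_const (fun _ => half_pos hδ) hS hSU hfU
  refine ⟨g, g.contMDiff, ⟨δ / 2, half_pos hδ, fun p => ?_⟩, fun x => ?_, fun x => ?_⟩
  · have := norm_sub_norm_le (f p) (g p)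
    rw [← dist_eq_norm, dist_comm] at this
    linarith [hg p, hKδ (projIcc 0 1 zero_le_one p.2, p.1)]
  · rw [hgS (.inl (le_refl (-1 : ℝ))), hf₀ _ (by norm_num)]
  · rw [hgS (.inr (le_refl (2 : ℝ))), hf₁ _ (by norm_num)]

end SmoothHomotopy

section Torus

open scoped Manifold Real

/-- The universal covering of the three-torus. -/
noncomputable def torusExp (θ : Fin 3 → ℝ) : Circle × Circle × Circle :=
  (Circle.exp (θ 0), Circle.exp (θ 1), Circle.exp (θ 2))

theorem contMDiff_torusExp :
    ContMDiff 𝓘(ℝ, Fin 3 → ℝ) ((𝓡 1).prod ((𝓡 1).prod (𝓡 1))) ∞ torusExp := by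
  have h (i : Fin 3) : ContMDiff 𝓘(ℝ, Fin 3 → ℝ) (𝓡 1) ∞ fun θ : Fin 3 → ℝ => Circle.exp (θ i) :=
    contMDiff_circleExp.comp (contDiff_apply ℝ ℝ i).contMDiff
  exact (h 0).prodMk ((h 1).prodMk (h 2))

theorem periodic_torusExp (j : Fin 3) : Function.Periodic torusExp (Pi.single j (2 * π)) :=
  fun θ => by fin_cases j <;> simp [torusExp, Circle.exp_add]

theorem exists_forall_periodIntegral_rayForm_eq
    {f g : C(Circle × Circle × Circle, Punctured (ℝ × (Fin 3 → ℝ)))}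
    (hf : ContMDiff ((𝓡 1).prod ((𝓡 1).prod (𝓡 1))) 𝓘(ℝ, ℝ × (Fin 3 → ℝ)) ∞
      fun k => (f k : ℝ × (Fin 3 → ℝ)))
    (hg : ContMDiff ((𝓡 1).prod ((𝓡 1).prod (𝓡 1))) 𝓘(ℝ, ℝ × (Fin 3 → ℝ)) ∞
      fun k => (g k : ℝ × (Fin 3 → ℝ))) (h : f.Homotopic g) :
    ∃ δ > 0, ∀ ρ : ContDiffBump (0 : Fin 3 → ℝ), ρ.rOut < δ →
      periodIntegral (rayForm ρ) (fun θ => (f (torusExp θ) : ℝ × (Fin 3 → ℝ))) =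
        periodIntegral (rayForm ρ) (fun θ => (g (torusExp θ) : ℝ × (Fin 3 → ℝ))) := by
  obtain ⟨K, hK, ⟨δ, hδ, hKδ⟩, hKf, hKg⟩ := exists_contMDiff_homotopy_norm_ge _ hf hg h
  refine ⟨δ, hδ, fun ρ hρ => ?_⟩
  let F : (Fin 4 → ℝ) → ℝ × (Fin 3 → ℝ) := fun θ => K (torusExp (Fin.tail θ), θ 0)
  have hF : ContDiff ℝ ∞ F := by
    refine contMDiff_iff_contDiff.1 (hK.comp (.prodMk ?_ (contDiff_apply ℝ ℝ 0).contMDiff))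
    exact contMDiff_torusExp.comp
      (contDiff_pi.2 fun j : Fin 3 => contDiff_apply ℝ ℝ j.succ).contMDiff
  have hper (j : Fin 3) : Function.Periodic F (Pi.single j.succ (2 * π)) := fun θ => by
    have htail : Fin.tail (θ + Pi.single j.succ (2 * π)) = Fin.tail θ + Pi.single j (2 * π) :=
      funext fun i => by simp [Fin.tail, Pi.single_apply]
    simp [F, htail, periodic_torusExp j _]
  have hslice := periodIntegral_slice_eq ((contDiff_rayForm ρ).differentiable (by simp))
    (contDiff_infty.1 hF 2) hper
    (by norm_num : (-1 : ℝ) ≤ 2) fun θ _ => extDeriv_rayForm ρ (hρ.trans_le (hKδ _))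
  simpa only [F, Fin.tail_cons, Fin.cons_zero, hKf, hKg] using hslice

end Torus

section Spinors

/-- The action of the vectors of `ℝ³` on `ℂ²` by Pauli matrices. -/
noncomputable def spin : E3 →ₗ[ℝ] (ℂ × ℂ) →ₗ[ℂ] ℂ × ℂ :=
  LinearMap.mk₂' ℝ ℂ (fun v ψ =>
    (v 2 * ψ.1 + (v 0 - v 1 * Complex.I) * ψ.2, (v 0 + v 1 * Complex.I) * ψ.1 - v 2 * ψ.2))
    (fun v w ψ => by ext <;> simp <;> ring) (fun a v ψ => by ext <;> simp <;> ring)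
    (fun v ψ φ => by ext <;> simp <;> ring) (fun a v ψ => by ext <;> simp <;> ring)

theorem spin_apply (v : E3) (ψ : ℂ × ℂ) :
    spin v ψ =
      (v 2 * ψ.1 + (v 0 - v 1 * Complex.I) * ψ.2, (v 0 + v 1 * Complex.I) * ψ.1 - v 2 * ψ.2) :=
  rfl

/-- A spinor in the direction of `v`: an eigenvector of the action of `v` for the eigenvalue
`‖v‖`. For `v ≠ 0` it is unique up to a complex factor. -/
def IsSpinor (v : E3) (ψ : ℂ × ℂ) : Prop :=
  ψ ≠ 0 ∧ spin v ψ = ‖v‖ • ψ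

/-- The area form on `ℂ²`. -/
def wedge (ψ φ : ℂ × ℂ) : ℂ := ψ.1 * φ.2 - ψ.2 * φ.1

theorem continuous_spin : Continuous fun q : E3 × (ℂ × ℂ) => spin q.1 q.2 := by
  simp only [spin_apply]
  fun_prop

theorem norm_sq_E3 (v : E3) : ‖v‖ ^ 2 = v 0 ^ 2 + v 1 ^ 2 + v 2 ^ 2 := by
  rw [EuclideanSpace.real_norm_sq_eq, Fin.sum_univ_three]

theorem spin_spin (v : E3) (ψ : ℂ × ℂ) : spin v (spin v ψ) = ‖v‖ ^ 2 • ψ := by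
  rw [norm_sq_E3]
  ext <;> simp only [spin_apply, Prod.smul_fst, Prod.smul_snd, Complex.real_smul] <;> push_cast
  · linear_combination (-(v 1 : ℂ) ^ 2 * ψ.1) * Complex.I_sq
  · linear_combination (-(v 1 : ℂ) ^ 2 * ψ.2) * Complex.I_sq

theorem eq_zero_of_spin_eq_zero {v : E3} {ψ : ℂ × ℂ} (hψ : ψ ≠ 0) (h : spin v ψ = 0) : v = 0 := by
  have hsq : ‖v‖ ^ 2 • ψ = 0 := by rw [← spin_spin, h, map_zero]
  simpa [hψ] using hsq

theorem exists_eq_smul_of_wedge_eq_zero {ψ φ : ℂ × ℂ} (hψ : ψ ≠ 0) (h : wedge ψ φ = 0) :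
    ∃ c : ℂ, φ = c • ψ := by
  unfold wedge at h
  by_cases h₁ : ψ.1 = 0
  · have h₂ : ψ.2 ≠ 0 := fun h₂ => hψ (Prod.ext h₁ h₂)
    have hφ : φ.1 = 0 := by simpa [h₁, h₂] using h
    exact ⟨φ.2 / ψ.2, Prod.ext (by simp [h₁, hφ]) (by simp [h₂])⟩
  · refine ⟨φ.1 / ψ.1, Prod.ext (by simp [h₁]) ?_⟩
    simp only [Prod.smul_snd, smul_eq_mul]
    field_simp
    linear_combination h

theorem IsSpinor.of_smul {v : E3} {ψ : ℂ × ℂ} {c : ℂ} (h : IsSpinor v (c • ψ)) :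
    IsSpinor v ψ := by
  obtain ⟨hc, hψ⟩ := smul_ne_zero_iff.1 h.1
  refine ⟨hψ, smul_right_injective _ hc ?_⟩
  simpa only [map_smul, smul_comm c] using h.2

theorem IsSpinor.sameRay {v w : E3} {ψ : ℂ × ℂ} (hv : IsSpinor v ψ) (hw : IsSpinor w ψ) :
    SameRay ℝ v w := by
  rw [sameRay_iff_norm_smul_eq, ← sub_eq_zero]
  refine eq_zero_of_spin_eq_zero hv.1 ?_
  simp only [map_sub, map_smul, LinearMap.sub_apply, LinearMap.smul_apply, hv.2, hw.2]
  rw [smul_comm, sub_self]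

theorem sameRay_of_wedge_eq_zero {v w : E3} {ψ φ : ℂ × ℂ} (hψ : IsSpinor v ψ)
    (hφ : IsSpinor w φ) (h : wedge ψ φ = 0) : SameRay ℝ v w := by
  obtain ⟨c, rfl⟩ := exists_eq_smul_of_wedge_eq_zero hψ.1 h
  exact hψ.sameRay hφ.of_smul

/-- Transport of a spinor in the direction of `v` to the direction of `w`, by projection to the
eigenspace. It vanishes only if the two directions are opposite. -/
noncomputable def transport (v w : E3) (ψ : ℂ × ℂ) : ℂ × ℂ :=
  (2 * ‖v‖)⁻¹ • (‖w‖ • ψ + spin w ψ)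

theorem transport_self {v : E3} {ψ : ℂ × ℂ} (hv : v ≠ 0) (hψ : IsSpinor v ψ) :
    transport v v ψ = ψ := by
  rw [transport, hψ.2, ← two_smul ℝ, smul_smul 2, inv_smul_smul₀ (by simpa using hv)]

theorem isSpinor_transport {v w : E3} {ψ : ℂ × ℂ} (hv : v ≠ 0) (hψ : IsSpinor v ψ)
    (h : ‖v‖ • w + ‖w‖ • v ≠ 0) : IsSpinor w (transport v w ψ) := by
  refine ⟨fun h0 => h (eq_zero_of_spin_eq_zero hψ.1 ?_), ?_⟩
  · have hsum : ‖w‖ • ψ + spin w ψ = 0 := (smul_eq_zero.1 h0).resolve_left (by simpa using hv)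
    simp only [map_add, map_smul, LinearMap.add_apply, LinearMap.smul_apply, hψ.2]
    rw [smul_comm ‖w‖, ← smul_add, add_comm, hsum, smul_zero]
  · have hreal (a : ℝ) (φ : ℂ × ℂ) : spin w (a • φ) = a • spin w φ :=
      (spin w).map_smul_of_tower a φ
    rw [transport, hreal, map_add, hreal, spin_spin, smul_comm]
    congr 1
    rw [smul_add, smul_smul, pow_two, add_comm]

/-- Three nonzero vectors which do not all have the same direction. -/
def Admissible (v : Fin 3 → E3) : Prop :=
  (∀ i, v i ≠ 0) ∧ ¬ (SameRay ℝ (v 0) (v 1) ∧ SameRay ℝ (v 1) (v 2))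

theorem Admissible.of_forall {v : Fin 3 → E3} (h0 : ∀ i, v i ≠ 0)
    (h : ∀ (n : E3) (c : Fin 3 → ℝ), (∀ i, 0 < c i) → (∀ i, v i = c i • n) → n = 0) :
    Admissible v := by
  refine ⟨h0, fun ⟨h1, h2⟩ => h0 1 (h (v 1) (fun i => ‖v 1‖⁻¹ * ‖v i‖) (fun i => ?_) fun i => ?_)⟩
  · exact mul_pos (inv_pos.2 (norm_pos_iff.2 (h0 1))) (norm_pos_iff.2 (h0 i))
  · have hi : SameRay ℝ (v 1) (v i) := by
      fin_cases i
      exacts [h1.symm, .rfl, h2]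
    rw [mul_smul, ← hi.norm_smul_eq, inv_smul_smul₀ (norm_ne_zero_iff.2 (h0 1))]

/-- The area forms of the first two and of the last two of three spinors. -/
def wedgePair (ψ : Fin 3 → ℂ × ℂ) : ℂ × ℂ := (wedge (ψ 0) (ψ 1), wedge (ψ 1) (ψ 2))

theorem continuous_wedgePair : Continuous wedgePair := by
  unfold wedgePair wedge
  fun_prop

theorem wedgePair_ne_zero {v : Fin 3 → E3} (hv : Admissible v) {ψ : Fin 3 → ℂ × ℂ}
    (hψ : ∀ i, IsSpinor (v i) (ψ i)) : wedgePair ψ ≠ 0 := fun h =>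
  hv.2 ⟨sameRay_of_wedge_eq_zero (hψ 0) (hψ 1) (congrArg Prod.fst h),
    sameRay_of_wedge_eq_zero (hψ 1) (hψ 2) (congrArg Prod.snd h)⟩

end Spinors

section SpinorMaps

open Topology

variable {K T : Type*} [TopologicalSpace K] [TopologicalSpace T]

theorem continuous_transport {v w : K → E3} {ψ : K → ℂ × ℂ} (hv : Continuous v)
    (hw : Continuous w) (hψ : Continuous ψ) (hv0 : ∀ k, v k ≠ 0) :
    Continuous fun k => transport (v k) (w k) (ψ k) := by
  refine Continuous.smul (M := ℝ) ?_ ((hw.norm.smul hψ).add (continuous_spin.comp (hw.prodMk hψ)))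
  exact (continuous_const.mul hv.norm).inv₀ fun k => by simpa using hv0 k

/-- `F` is the map to `ℂ² ∖ 0` defined by some continuous choice of spinors for the family `v` of
triples of vectors. -/
def IsSpinorMap (v : K → Fin 3 → E3) (F : C(K, Punctured (ℂ × ℂ))) : Prop :=
  ∃ ψ : K → Fin 3 → ℂ × ℂ, Continuous ψ ∧ (∀ k i, IsSpinor (v k i) (ψ k i)) ∧
    ∀ k, (F k : ℂ × ℂ) = wedgePair (ψ k)

theorem IsSpinorMap.exists_homotopic_of_ne {V : unitInterval → K → Fin 3 → E3}
    (hV : Continuous fun q : unitInterval × K => V q.1 q.2) (hadm : ∀ t k, Admissible (V t k))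
    (h : ∀ t k i, ‖V 0 k i‖ • V t k i + ‖V t k i‖ • V 0 k i ≠ 0)
    {F : C(K, Punctured (ℂ × ℂ))} (hF : IsSpinorMap (V 0) F) :
    ∃ F', IsSpinorMap (V 1) F' ∧ F.Homotopic F' := by
  obtain ⟨ψ, hψc, hψ, hFψ⟩ := hF
  let Ψ : unitInterval × K → Fin 3 → ℂ × ℂ := fun q i =>
    transport (V 0 q.2 i) (V q.1 q.2 i) (ψ q.2 i)
  have hΨ (q) (i) : IsSpinor (V q.1 q.2 i) (Ψ q i) :=
    isSpinor_transport ((hadm 0 q.2).1 i) (hψ _ _) (h _ _ _)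
  have hΨc : Continuous Ψ := continuous_pi fun i =>
    continuous_transport
      ((continuous_apply i).comp (hV.comp (continuous_const.prodMk continuous_snd)))
      ((continuous_apply i).comp hV) ((continuous_apply i).comp (hψc.comp continuous_snd))
      fun q => (hadm 0 q.2).1 i
  let H : C(unitInterval × K, Punctured (ℂ × ℂ)) :=
    ⟨fun q => ⟨wedgePair (Ψ q), wedgePair_ne_zero (hadm _ _) (hΨ q)⟩,
      (continuous_wedgePair.comp hΨc).subtype_mk _⟩
  refine ⟨H.comp (.prodMk (.const K 1) (.id K)),
    ⟨fun k => Ψ (1, k), hΨc.comp (by fun_prop), fun k => hΨ (1, k), fun k => rfl⟩,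
    ⟨⟨H, fun k => Subtype.ext ?_, fun k => rfl⟩⟩⟩
  have hzero : Ψ (0, k) = ψ k := funext fun i => transport_self ((hadm _ _).1 i) (hψ k i)
  simp only [H, hzero, hFψ]

theorem eventually_forall_norm_smul_add_norm_smul_ne_zero [CompactSpace K]
    {V : T → K → Fin 3 → E3} (hV : Continuous fun q : T × K => V q.1 q.2)
    (h0 : ∀ τ k i, V τ k i ≠ 0) (τ : T) :
    ∀ᶠ s : T × T in 𝓝 (τ, τ), ∀ k i, ‖V s.1 k i‖ • V s.2 k i + ‖V s.2 k i‖ • V s.1 k i ≠ 0 := by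
  suffices h : ∀ᶠ s : T × T in 𝓝 (τ, τ), ∀ k ∈ (univ : Set K), ∀ i,
      ‖V s.1 k i‖ • V s.2 k i + ‖V s.2 k i‖ • V s.1 k i ≠ 0 by simpa using h
  refine isCompact_univ.eventually_forall_of_forall_eventually fun k _ =>
    Filter.eventually_all.2 fun i => ContinuousAt.eventually_ne (Continuous.continuousAt ?_) ?_
  · have h₁ : Continuous fun q : (T × T) × K => V q.1.1 q.2 i :=
      (continuous_apply i).comp (hV.comp (continuous_fst.fst.prodMk continuous_snd))
    have h₂ : Continuous fun q : (T × T) × K => V q.1.2 q.2 i :=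
      (continuous_apply i).comp (hV.comp (continuous_fst.snd.prodMk continuous_snd))
    exact (h₁.norm.smul h₂).add (h₂.norm.smul h₁)
  · simpa [← two_smul ℝ (‖V τ k i‖ • V τ k i)] using h0 τ k i

theorem IsSpinorMap.exists_homotopic [CompactSpace K] [PreconnectedSpace T]
    [LocallyPathConnectedSpace T] {V : T → K → Fin 3 → E3}
    (hV : Continuous fun q : T × K => V q.1 q.2) (hadm : ∀ τ k, Admissible (V τ k)) (τ τ' : T)
    {F : C(K, Punctured (ℂ × ℂ))} (hF : IsSpinorMap (V τ) F) :
    ∃ F', IsSpinorMap (V τ') F' ∧ F.Homotopic F' := by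
  let P : T → T → Prop := fun τ τ' => ∀ F, IsSpinorMap (V τ) F →
    ∃ F', IsSpinorMap (V τ') F' ∧ F.Homotopic F'
  suffices P τ τ' from this F hF
  have htrans : IsTrans T P := ⟨fun a b c hab hbc F hF => by
    obtain ⟨F', hF', hom⟩ := hab F hF
    obtain ⟨F'', hF'', hom'⟩ := hbc F' hF'
    exact ⟨F'', hF'', hom.trans hom'⟩⟩
  refine PreconnectedSpace.induction₂' P (fun τ₀ => ?_) htrans τ τ'
  have hne := eventually_forall_norm_smul_add_norm_smul_ne_zero hV (fun τ k => (hadm τ k).1) τ₀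
  rw [nhds_prod_eq] at hne
  obtain ⟨U, hU, hne⟩ := Filter.eventually_prod_self_iff'.1 hne
  have hP (a b : T) (γ : Path a b) (hγ : ∀ t, γ t ∈ U) : P a b := fun F hF => by
    have := IsSpinorMap.exists_homotopic_of_ne (V := fun t => V (γ t)) (F := F)
      (hV.comp ((γ.continuous.comp continuous_fst).prodMk continuous_snd)) (fun t => hadm (γ t))
      (fun t => hne _ (hγ 0) _ (hγ t)) (by simpa using hF)
    simpa using this
  filter_upwards [pathComponentIn_mem_nhds hU] with b ⟨γ, hγ⟩
  exact ⟨hP _ _ γ hγ, hP _ _ γ.symm fun t => hγ _⟩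

theorem homotopic_of_zero_notMem_segment {E : Type*} [AddCommGroup E] [Module ℝ E]
    [TopologicalSpace E] [ContinuousAdd E] [ContinuousSMul ℝ E] {f g : C(K, Punctured E)}
    (h : ∀ k, (0 : E) ∉ segment ℝ (f k : E) (g k)) : f.Homotopic g := by
  refine ⟨⟨⟨fun q => ⟨(1 - (q.1 : ℝ)) • (f q.2 : E) + (q.1 : ℝ) • (g q.2 : E), fun h0 =>
    h q.2 ⟨_, _, sub_nonneg.2 q.1.2.2, q.1.2.1, sub_add_cancel _ _, h0⟩⟩, ?_⟩,
    fun k => Subtype.ext (by simp), fun k => Subtype.ext (by simp)⟩⟩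
  fun_prop

theorem IsSpinorMap.exists_homotopic_const {v : Fin 3 → E3} (hv : Admissible v)
    {F : C(K, Punctured (ℂ × ℂ))} (hF : IsSpinorMap (fun _ => v) F) :
    ∃ c, F.Homotopic (.const K c) := by
  obtain ⟨ψ, -, hψ, hFψ⟩ := hF
  rcases not_and_or.1 hv.2 with h | h
  · refine ⟨⟨(0, 1), by simp⟩, homotopic_of_zero_notMem_segment fun k => ?_⟩
    rintro ⟨a, b, -, -, hab, h0⟩
    have hw : wedge (ψ k 0) (ψ k 1) ≠ 0 := fun hw =>
      h (sameRay_of_wedge_eq_zero (hψ k 0) (hψ k 1) hw)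
    simp_all [wedgePair, Prod.ext_iff]
  · refine ⟨⟨(1, 0), by simp⟩, homotopic_of_zero_notMem_segment fun k => ?_⟩
    rintro ⟨a, b, -, -, hab, h0⟩
    have hw : wedge (ψ k 1) (ψ k 2) ≠ 0 := fun hw =>
      h (sameRay_of_wedge_eq_zero (hψ k 1) (hψ k 2) hw)
    simp_all [wedgePair, Prod.ext_iff]

end SpinorMaps

section GreatCircles

theorem circle_re_sq_add_im_sq (z : Circle) : (z : ℂ).re ^ 2 + (z : ℂ).im ^ 2 = 1 := by
  simpa [Complex.normSq_apply, pow_two] using Circle.normSq_coe z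

theorem mul_sub_one_add_mul_ne_zero {r s q : ℝ} (hr : 0 ≤ r) (hs : |s| ≤ 1) (hq : |q| = 1) :
    r * s - (1 + r) * q ≠ 0 := fun h => by
  have h' : (1 + r) * |q| = r * |s| := by
    rw [← abs_of_nonneg (add_nonneg zero_le_one hr), ← abs_mul, ← sub_eq_zero.1 h, abs_mul,
      abs_of_nonneg hr]
  rw [hq] at h'
  linarith [mul_le_mul_of_nonneg_left hs hr]

theorem abs_im_eq_one_of_re_eq_zero {z : Circle} (h : (z : ℂ).re = 0) : |(z : ℂ).im| = 1 :=
  (abs_eq zero_le_one).2 (by simpa [h] using circle_re_sq_add_im_sq z)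

theorem abs_re_eq_one_of_im_eq_zero {z : Circle} (h : (z : ℂ).im = 0) : |(z : ℂ).re| = 1 :=
  (abs_eq zero_le_one).2 (by simpa [h] using circle_re_sq_add_im_sq z)

theorem abs_re_le_one (z : Circle) : |(z : ℂ).re| ≤ 1 :=
  (Complex.abs_re_le_norm z).trans_eq (Circle.norm_coe z)

theorem abs_im_le_one (z : Circle) : |(z : ℂ).im| ≤ 1 :=
  (Complex.abs_im_le_norm z).trans_eq (Circle.norm_coe z)

theorem continuous_vec3 {X : Type*} [TopologicalSpace X] {a b c : X → ℝ} (ha : Continuous a)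
    (hb : Continuous b) (hc : Continuous c) : Continuous fun x => (!₂[a x, b x, c x] : E3) :=
  (PiLp.continuous_toLp 2 _).comp <| continuous_pi fun i => by fin_cases i <;> assumption

/-- A deformation of a triple of great circles, at `r = 0`, to the differences of the components of
the Borromean rings, at `r = 1`. -/
noncomputable def stdVec (r : ℝ) (k : Circle × Circle × Circle) : Fin 3 → E3 :=
  ![!₂[-(k.2.1 : ℂ).re, 2 * r * (k.1 : ℂ).re, r * (k.1 : ℂ).im - (1 + r) * (k.2.1 : ℂ).im],
    !₂[r * (k.2.1 : ℂ).re - (1 + r) * (k.2.2 : ℂ).re, -(k.2.2 : ℂ).im, 2 * r * (k.2.1 : ℂ).im],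
    !₂[2 * r * (k.2.2 : ℂ).re, r * (k.2.2 : ℂ).im - (1 + r) * (k.1 : ℂ).re, -(k.1 : ℂ).im]]

theorem continuous_stdVec :
    Continuous fun q : ℝ × (Circle × Circle × Circle) => stdVec q.1 q.2 := by
  refine continuous_pi fun i => ?_
  fin_cases i <;> exact continuous_vec3 (by fun_prop) (by fun_prop) (by fun_prop)

theorem stdVec_ne_zero {r : ℝ} (hr : 0 ≤ r) (k : Circle × Circle × Circle) (i : Fin 3) :
    stdVec r k i ≠ 0 := fun h => by
  obtain ⟨x, y, z⟩ := k
  have hcoord (j : Fin 3) : stdVec r (x, y, z) i j = 0 := by simp [h]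
  fin_cases i
  · exact mul_sub_one_add_mul_ne_zero hr (abs_im_le_one x)
      (abs_im_eq_one_of_re_eq_zero (by simpa [stdVec] using hcoord 0))
      (by simpa [stdVec] using hcoord 2)
  · exact mul_sub_one_add_mul_ne_zero hr (abs_re_le_one y)
      (abs_re_eq_one_of_im_eq_zero (by simpa [stdVec] using hcoord 1))
      (by simpa [stdVec] using hcoord 0)
  · exact mul_sub_one_add_mul_ne_zero hr (abs_im_le_one z)
      (abs_re_eq_one_of_im_eq_zero (by simpa [stdVec] using hcoord 2))
      (by simpa [stdVec] using hcoord 1)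

theorem stdVec_relation (r : ℝ) (k : Circle × Circle × Circle) (i : Fin 3) :
    2 * r ^ 2 * stdVec r k i i + 2 * r * stdVec r k (i + 1) i +
      (1 + r) * stdVec r k (i + 2) i = 0 := by
  fin_cases i <;> simp [stdVec] <;> ring

theorem admissible_stdVec {r : ℝ} (hr : 0 ≤ r) (k : Circle × Circle × Circle) :
    Admissible (stdVec r k) := by
  refine .of_forall (stdVec_ne_zero hr k) fun n c hc h => ?_
  ext i
  have hrel := stdVec_relation r k i
  simp only [h, PiLp.smul_apply, smul_eq_mul] at hrel
  have hpos : 0 < 2 * r ^ 2 * c i + 2 * r * c (i + 1) + (1 + r) * c (i + 2) := by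
    have := hc i
    have := hc (i + 1)
    have := hc (i + 2)
    positivity
  refine (mul_eq_zero.1 ?_).resolve_left hpos.ne'
  linear_combination hrel

/-- Spinors for the triple of great circles. -/
noncomputable def stdSpinor (k : Circle × Circle × Circle) : Fin 3 → ℂ × ℂ :=
  ![(k.2.1 - Complex.I, Complex.I * k.2.1 - 1), (1, -k.2.2),
    (1 + Complex.I * k.1, 1 - Complex.I * k.1)]

theorem continuous_stdSpinor : Continuous stdSpinor := by
  refine continuous_pi fun i => ?_
  fin_cases i <;> exact Continuous.prodMk (by fun_prop) (by fun_prop)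

theorem norm_stdVec_zero (k : Circle × Circle × Circle) (i : Fin 3) : ‖stdVec 0 k i‖ = 1 := by
  rw [← sq_eq_sq₀ (norm_nonneg _) one_pos.le, norm_sq_E3, one_pow]
  fin_cases i
  · simpa [stdVec] using circle_re_sq_add_im_sq k.2.1
  · simpa [stdVec] using circle_re_sq_add_im_sq k.2.2
  · simpa [stdVec] using circle_re_sq_add_im_sq k.1

theorem stdSpinor_ne_zero (k : Circle × Circle × Circle) (i : Fin 3) : stdSpinor k i ≠ 0 := by
  intro h
  have h₁ := congrArg Prod.fst h
  have h₂ := congrArg Prod.snd h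
  fin_cases i
  · change (k.2.1 : ℂ) - Complex.I = 0 at h₁
    change Complex.I * (k.2.1 : ℂ) - 1 = 0 at h₂
    refine two_ne_zero (α := ℂ) ?_
    linear_combination Complex.I * h₁ - h₂ + Complex.I_sq
  · exact one_ne_zero h₁
  · change 1 + Complex.I * (k.1 : ℂ) = 0 at h₁
    change 1 - Complex.I * (k.1 : ℂ) = 0 at h₂
    refine two_ne_zero (α := ℂ) ?_
    linear_combination h₁ + h₂

theorem isSpinor_stdSpinor (k : Circle × Circle × Circle) (i : Fin 3) :
    IsSpinor (stdVec 0 k i) (stdSpinor k i) := by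
  refine ⟨stdSpinor_ne_zero k i, ?_⟩
  rw [norm_stdVec_zero, one_smul]
  have hx := circle_re_sq_add_im_sq k.1
  have hy := circle_re_sq_add_im_sq k.2.1
  have hz := circle_re_sq_add_im_sq k.2.2
  fin_cases i <;> ext1 <;> apply Complex.ext <;>
    simp [spin_apply, stdVec, stdSpinor] <;> linarith

/-- The map of the three-torus to `ℂ² ∖ 0` defined by the spinors of the great circles. -/
noncomputable def stdMap : C(Circle × Circle × Circle, Punctured (ℂ × ℂ)) :=
  ⟨fun k => ⟨wedgePair (stdSpinor k),
    wedgePair_ne_zero (admissible_stdVec le_rfl k) (isSpinor_stdSpinor k)⟩,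
    (continuous_wedgePair.comp continuous_stdSpinor).subtype_mk _⟩

theorem isSpinorMap_stdMap : IsSpinorMap (stdVec 0) stdMap :=
  ⟨stdSpinor, continuous_stdSpinor, isSpinor_stdSpinor, fun _ => rfl⟩

theorem stdMap_apply (k : Circle × Circle × Circle) :
    (stdMap k : ℂ × ℂ) = (1 - k.2.1 * k.2.2 + Complex.I * (k.2.2 - k.2.1),
      1 + k.2.2 - Complex.I * k.1 * (1 - k.2.2)) := by
  ext <;> simp [stdMap, wedgePair, wedge, stdSpinor] <;> ring

end GreatCircles

section StandardMap

open MeasureTheory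
open scoped Manifold Real

/-- The real coordinates of `ℂ²`, ordered so that the ray of the closed form `rayForm` consists of
the points `(0, -t)` with `t > 0`. -/
noncomputable def realCoords : ℂ × ℂ →L[ℝ] ℝ × (Fin 3 → ℝ) :=
  (Complex.reCLM.comp (.snd ℝ ℂ ℂ)).prod
    (.pi ![Complex.reCLM.comp (.fst ℝ ℂ ℂ), Complex.imCLM.comp (.fst ℝ ℂ ℂ),
      Complex.imCLM.comp (.snd ℝ ℂ ℂ)])

theorem realCoords_apply (c : ℂ × ℂ) :
    realCoords c = (c.2.re, ![c.1.re, c.1.im, c.2.im]) := by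
  ext i <;> try fin_cases i
  all_goals rfl

theorem realCoords_ne_zero {c : ℂ × ℂ} (hc : c ≠ 0) : realCoords c ≠ 0 := fun h => hc <| by
  rw [realCoords_apply, Prod.mk_eq_zero] at h
  have h' (i : Fin 3) := congrFun h.2 i
  exact Prod.ext (Complex.ext (h' 0) (h' 1)) (Complex.ext h.1 (h' 2))

/-- The map `realCoords` between the punctured spaces. -/
noncomputable def puncturedRealCoords : C(Punctured (ℂ × ℂ), Punctured (ℝ × (Fin 3 → ℝ))) :=
  ⟨fun c => ⟨realCoords c, realCoords_ne_zero c.2⟩,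
    (realCoords.continuous.comp continuous_subtype_val).subtype_mk _⟩

attribute [local instance] finrank_real_complex_fact'

theorem contMDiff_realCoords_stdMap :
    ContMDiff ((𝓡 1).prod ((𝓡 1).prod (𝓡 1))) 𝓘(ℝ, ℝ × (Fin 3 → ℝ)) ∞
      fun k => realCoords (stdMap k) := by
  have hcoe : ContMDiff (𝓡 1) 𝓘(ℝ, ℂ) ∞ fun z : Circle => (z : ℂ) := contMDiff_coe_sphere
  have hpoly : ContDiff ℝ ∞ fun p : ℂ × ℂ × ℂ => realCoords
      (1 - p.2.1 * p.2.2 + Complex.I * (p.2.2 - p.2.1),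
        1 + p.2.2 - Complex.I * p.1 * (1 - p.2.2)) := by fun_prop
  have hincl : ContMDiff ((𝓡 1).prod ((𝓡 1).prod (𝓡 1))) 𝓘(ℝ, ℂ × ℂ × ℂ) ∞
      fun k : Circle × Circle × Circle => ((k.1 : ℂ), (k.2.1 : ℂ), (k.2.2 : ℂ)) :=
    (hcoe.comp contMDiff_fst).prodMk_space
      ((hcoe.comp (contMDiff_fst.comp contMDiff_snd)).prodMk_space
        (hcoe.comp (contMDiff_snd.comp contMDiff_snd)))
  exact (hpoly.contMDiff.comp hincl).congr fun k => by rw [stdMap_apply]; rfl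

/-- The lift of the map `stdMap` to the universal covering of the torus. -/
noncomputable def stdLift (θ : Fin 3 → ℝ) : ℝ × (Fin 3 → ℝ) :=
  realCoords (stdMap (torusExp θ))

theorem contDiff_stdLift : ContDiff ℝ ∞ stdLift :=
  contMDiff_iff_contDiff.1 (contMDiff_realCoords_stdMap.comp contMDiff_torusExp)

theorem stdLift_apply (θ : Fin 3 → ℝ) :
    stdLift θ = (1 + Real.cos (θ 2) + Real.sin (θ 0) - Real.sin (θ 0 + θ 2),
      ![1 - Real.cos (θ 1 + θ 2) - Real.sin (θ 2) + Real.sin (θ 1),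
        -Real.sin (θ 1 + θ 2) + Real.cos (θ 2) - Real.cos (θ 1),
        Real.sin (θ 2) - Real.cos (θ 0) + Real.cos (θ 0 + θ 2)]) := by
  rw [stdLift, realCoords_apply, stdMap_apply]
  ext i <;> try fin_cases i
  all_goals
    simp [torusExp, Real.cos_add, Real.sin_add, Complex.exp_ofReal_mul_I_re,
      Complex.exp_ofReal_mul_I_im]
    ring

theorem det_fderiv_stdLift (θ : Fin 3 → ℝ) :
    Matrix.det (.of fun j => (fderiv ℝ stdLift θ (Pi.single j 1)).2) =
      (Real.sin (θ 0) - Real.sin (θ 0 + θ 2)) *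
        (Real.sin (θ 1 - θ 2) - (Real.cos (θ 1) + Real.cos (θ 2))) := by
  have hx (i : Fin 3) := hasFDerivAt_apply (𝕜 := ℝ) (F' := fun _ : Fin 3 => ℝ) i θ
  have hcoord (i j : Fin 3) : (fderiv ℝ stdLift θ (Pi.single j 1)).2 i =
      fderiv ℝ (fun θ => (stdLift θ).2 i) θ (Pi.single j 1) := by
    have hd := (contDiff_stdLift.differentiable (by simp) θ).hasFDerivAt
    let coord : (ℝ × (Fin 3 → ℝ)) →L[ℝ] ℝ := (ContinuousLinearMap.proj i).comp (.snd ℝ ℝ _)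
    exact congrArg (· (Pi.single j 1)) (coord.hasFDerivAt.comp θ hd).fderiv.symm
  have h₀ : HasFDerivAt (fun θ : Fin 3 → ℝ =>
      1 - Real.cos (θ 1 + θ 2) - Real.sin (θ 2) + Real.sin (θ 1)) _ θ :=
    ((((hx 1).add (hx 2)).cos.const_sub 1).sub (hx 2).sin).add (hx 1).sin
  have h₁ : HasFDerivAt (fun θ : Fin 3 → ℝ =>
      -Real.sin (θ 1 + θ 2) + Real.cos (θ 2) - Real.cos (θ 1)) _ θ :=
    (((hx 1).add (hx 2)).sin.neg.add (hx 2).cos).sub (hx 1).cos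
  have h₂ : HasFDerivAt (fun θ : Fin 3 → ℝ =>
      Real.sin (θ 2) - Real.cos (θ 0) + Real.cos (θ 0 + θ 2)) _ θ :=
    ((hx 2).sin.sub (hx 0).cos).add ((hx 0).add (hx 2)).cos
  simp only [Matrix.det_fin_three, Matrix.of_apply, hcoord, stdLift_apply, Matrix.cons_val,
    h₀.fderiv, h₁.fderiv, h₂.fderiv]
  simp only [Pi.add_apply, Real.sin_add, Real.cos_add, Real.sin_sub, add_apply, sub_apply,
    neg_apply, smul_apply, ContinuousLinearMap.proj_apply, Pi.single_apply, smul_eq_mul]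
  have := Real.sin_sq_add_cos_sq (θ 1)
  have := Real.sin_sq_add_cos_sq (θ 2)
  grind

theorem le_cos_add_and_le_cos_sub {y z : ℝ}
    (h₀ : |1 - Real.cos (y + z) - Real.sin z + Real.sin y| ≤ 1 / 100)
    (h₁ : |-Real.sin (y + z) + Real.cos z - Real.cos y| ≤ 1 / 100) :
    1 - 1 / 10000 ≤ Real.cos (y + z) ∧ 1 - 1 / 10000 ≤ Real.cos (y - z) := by
  have hsum : (1 - Real.cos (y + z) - Real.sin z + Real.sin y) ^ 2 +
      (-Real.sin (y + z) + Real.cos z - Real.cos y) ^ 2 =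
        (2 - 2 * Real.cos (y + z)) + (2 - 2 * Real.cos (y - z)) := by
    have := Real.sin_sq_add_cos_sq y
    have := Real.sin_sq_add_cos_sq z
    rw [Real.cos_add, Real.sin_add, Real.cos_sub]
    grind
  have := sq_le_sq' (abs_le.1 h₀).1 (abs_le.1 h₀).2
  have := sq_le_sq' (abs_le.1 h₁).1 (abs_le.1 h₁).2
  have := Real.cos_le_one (y + z)
  have := Real.cos_le_one (y - z)
  constructor <;> linarith

theorem abs_sin_le_of_le_cos {t : ℝ} (h : 1 - 1 / 10000 ≤ Real.cos t) : |Real.sin t| ≤ 1 / 50 := by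
  have hcos : (1 - 1 / 10000) ^ 2 ≤ Real.cos t ^ 2 := pow_le_pow_left₀ (by norm_num) h 2
  exact abs_le_of_sq_le_sq (by linarith [Real.sin_sq_add_cos_sq t]) (by norm_num)

theorem one_add_cos_add_sin_sub_sin_pos {x z : ℝ} (hz : 1 - 1 / 10000 ≤ Real.cos z) :
    0 < 1 + Real.cos z + Real.sin x - Real.sin (x + z) := by
  have hcs : Real.cos x * Real.sin z ≤ 1 / 50 := by
    refine (le_abs_self _).trans ?_
    rw [abs_mul]
    exact (mul_le_of_le_one_left (abs_nonneg _) (Real.abs_cos_le_one x)).trans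
      (abs_sin_le_of_le_cos hz)
  have hsx := mul_nonneg (neg_le_iff_add_nonneg.1 (Real.neg_one_le_sin x))
    (sub_nonneg.2 (Real.cos_le_one z))
  rw [Real.sin_add]
  linarith

theorem cos_add_cos_le_sin_sub {x y z : ℝ}
    (hm : 1 + Real.cos z + Real.sin x - Real.sin (x + z) ≤ 0)
    (hP : 1 - 1 / 10000 ≤ Real.cos (y + z)) (hQ : 1 - 1 / 10000 ≤ Real.cos (y - z)) :
    Real.cos y + Real.cos z ≤ Real.sin (y - z) := by
  have hprod : (Real.cos y + Real.cos z) ^ 2 =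
      (1 + Real.cos (y + z)) * (1 + Real.cos (y - z)) := by
    have := Real.sin_sq_add_cos_sq y
    have := Real.sin_sq_add_cos_sq z
    rw [Real.cos_add, Real.cos_sub]
    grind
  have habs : 2 - 1 / 10000 ≤ |Real.cos y + Real.cos z| := by
    refine (le_abs_self _).trans (sq_le_sq.1 ?_)
    rw [hprod, pow_two]
    exact mul_le_mul (by linarith) (by linarith) (by norm_num) (by linarith)
  rcases le_or_gt (Real.cos y + Real.cos z) 0 with h | h
  · rw [abs_of_nonpos h] at habs
    linarith [(abs_le.1 (abs_sin_le_of_le_cos hQ)).1]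
  · rw [abs_of_pos h] at habs
    have hz : 1 - 1 / 10000 ≤ Real.cos z := by linarith [Real.cos_le_one y]
    exact absurd hm (one_add_cos_add_sin_sub_sin_pos hz).not_ge

theorem rayForm_stdLift (ρ : ContDiffBump (0 : Fin 3 → ℝ)) (θ : Fin 3 → ℝ) :
    rayForm ρ (stdLift θ) (fun j => fderiv ℝ stdLift θ (Pi.single j 1)) =
      Real.smoothTransition (-(stdLift θ).1 / ρ.rOut) * ρ (stdLift θ).2 *
        ((Real.sin (θ 0) - Real.sin (θ 0 + θ 2)) *
          (Real.sin (θ 1 - θ 2) - (Real.cos (θ 1) + Real.cos (θ 2)))) := by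
  rw [← det_fderiv_stdLift]
  rfl

theorem rayForm_stdLift_nonpos {ρ : ContDiffBump (0 : Fin 3 → ℝ)} (hρ : ρ.rOut ≤ 1 / 100)
    (θ : Fin 3 → ℝ) :
    rayForm ρ (stdLift θ) (fun j => fderiv ℝ stdLift θ (Pi.single j 1)) ≤ 0 := by
  rw [rayForm_stdLift]
  rcases le_or_gt 0 (stdLift θ).1 with hm | hm
  · rw [Real.smoothTransition.zero_of_nonpos
      (div_nonpos_of_nonpos_of_nonneg (neg_nonpos.2 hm) ρ.rOut_pos.le), zero_mul, zero_mul]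
  rcases le_or_gt ρ.rOut ‖(stdLift θ).2‖ with hq | hq
  · rw [ρ.zero_of_le_dist (by simpa using hq), mul_zero, zero_mul]
  have hcoord (i : Fin 3) : |(stdLift θ).2 i| ≤ 1 / 100 :=
    (norm_le_pi_norm _ i).trans (hq.le.trans hρ)
  have h₀ := hcoord 0
  have h₁ := hcoord 1
  rw [stdLift_apply] at hm h₀ h₁
  obtain ⟨hP, hQ⟩ := le_cos_add_and_le_cos_sub h₀ h₁
  refine mul_nonpos_of_nonneg_of_nonpos
    (mul_nonneg (Real.smoothTransition.nonneg _) ρ.nonneg) ?_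
  refine mul_nonpos_of_nonpos_of_nonneg ?_ (sub_nonneg.2 (cos_add_cos_le_sin_sub hm.le hP hQ))
  simp only at hm
  linarith [Real.neg_one_le_cos (θ 2)]

theorem rayForm_stdLift_ne_zero (ρ : ContDiffBump (0 : Fin 3 → ℝ)) :
    rayForm ρ (stdLift ![π / 2 + π, π, π])
      (fun j => fderiv ℝ stdLift ![π / 2 + π, π, π] (Pi.single j 1)) ≠ 0 := by
  have hlift : stdLift ![π / 2 + π, π, π] = (-2, 0) := by
    rw [stdLift_apply]
    ext i <;> try fin_cases i
    all_goals simp [Real.sin_add, Real.cos_add]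
    norm_num
  have hρ : ρ 0 = 1 := ρ.eventuallyEq_one.eq_of_nhds
  rw [rayForm_stdLift, hlift, hρ]
  refine mul_ne_zero (mul_ne_zero ?_ one_ne_zero) ?_
  · exact (Real.smoothTransition.pos_of_pos (div_pos (by norm_num) ρ.rOut_pos)).ne'
  · simp only [Matrix.cons_val, Real.sin_add, Real.sin_pi_div_two, Real.cos_pi, Real.sin_pi,
      sub_self]
    norm_num

theorem setIntegral_Icc_pos {n : ℕ} {f : (Fin n → ℝ) → ℝ} (hf : Continuous f) (hf₀ : 0 ≤ f)
    {a b x : Fin n → ℝ} (hx : ∀ i, x i ∈ Ioo (a i) (b i)) (hfx : f x ≠ 0) :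
    0 < ∫ x in Icc a b, f x := by
  rw [setIntegral_pos_iff_support_of_nonneg_ae (Filter.Eventually.of_forall hf₀)
    hf.integrableOn_Icc]
  have hopen : IsOpen (Function.support f ∩ univ.pi fun i => Ioo (a i) (b i)) :=
    hf.isOpen_support.inter (isOpen_set_pi finite_univ fun _ _ => isOpen_Ioo)
  refine (hopen.measure_pos volume ⟨x, hfx, fun i _ => hx i⟩).trans_le
    (measure_mono (inter_subset_inter_right _ fun y hy => ?_))
  exact ⟨fun i => (hy i trivial).1.le, fun i => (hy i trivial).2.le⟩

theorem periodIntegral_rayForm_stdLift_neg {ρ : ContDiffBump (0 : Fin 3 → ℝ)}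
    (hρ : ρ.rOut ≤ 1 / 100) : periodIntegral (rayForm ρ) stdLift < 0 := by
  have hcont : Continuous fun θ =>
      rayForm ρ (stdLift θ) fun j => fderiv ℝ stdLift θ (Pi.single j 1) := by
    simp only [rayForm_stdLift]
    have := contDiff_stdLift.continuous
    have := ρ.continuous
    have := Real.smoothTransition.continuous
    fun_prop
  rw [← neg_pos, periodIntegral, ← integral_neg]
  refine setIntegral_Icc_pos hcont.neg (fun θ => neg_nonneg.2 (rayForm_stdLift_nonpos hρ θ))
    (x := ![π / 2 + π, π, π]) (fun i => ?_) (neg_ne_zero.2 (rayForm_stdLift_ne_zero ρ))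
  have := Real.pi_pos
  fin_cases i <;> simp <;> constructor <;> linarith

theorem not_homotopic_const_stdMap (c : Punctured (ℂ × ℂ)) :
    ¬ stdMap.Homotopic (.const _ c) := fun h => by
  obtain ⟨δ, hδ, heq⟩ := exists_forall_periodIntegral_rayForm_eq contMDiff_realCoords_stdMap
    (contMDiff_const (c := (puncturedRealCoords c : ℝ × (Fin 3 → ℝ))))
    ((ContinuousMap.Homotopic.refl puncturedRealCoords).comp h)
  obtain ⟨r, hr, hr'⟩ := exists_between (lt_min hδ (by norm_num : (0 : ℝ) < 1 / 100))
  have hneg := periodIntegral_rayForm_stdLift_neg (ρ := ⟨r / 2, r, half_pos hr, half_lt_self hr⟩)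
    (hr'.le.trans (min_le_right _ _))
  exact hneg.ne ((heq _ (hr'.trans_le (min_le_left _ _))).trans
    (periodIntegral_const _ (puncturedRealCoords c : ℝ × (Fin 3 → ℝ))))

end StandardMap

section LinkHomotopy

variable {T : Type*} [TopologicalSpace T]

instance : LocallyPathConnectedSpace unitInterval := (convex_Icc 0 1).locallyPathConnectedSpace

/-- The differences of the components of a link. -/
noncomputable def linkVec (f : Fin 3 → Circle → E3) (k : Circle × Circle × Circle) : Fin 3 → E3 :=
  ![f 0 k.1 - f 1 k.2.1, f 1 k.2.1 - f 2 k.2.2, f 2 k.2.2 - f 0 k.1]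

theorem DisjointImages.sub_ne_zero {f : Fin 3 → Circle → E3} (hf : DisjointImages f) {i j : Fin 3}
    (hij : i ≠ j) (x y : Circle) : f i x - f j y ≠ 0 :=
  _root_.sub_ne_zero.2 ((hf hij).ne_of_mem (mem_range_self x) (mem_range_self y))

theorem admissible_linkVec {f : Fin 3 → Circle → E3} (hf : DisjointImages f)
    (k : Circle × Circle × Circle) : Admissible (linkVec f k) := by
  refine .of_forall (fun i => ?_) fun n c hc hn => ?_
  · fin_cases i <;> exact hf.sub_ne_zero (by decide) _ _
  · have hsum : (c 0 + c 1 + c 2) • n = 0 := by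
      simp [add_smul, ← hn, linkVec]
    exact (smul_eq_zero.1 hsum).resolve_left (add_pos (add_pos (hc 0) (hc 1)) (hc 2)).ne'

theorem continuous_linkVec {f : Fin 3 → T → Circle → E3}
    (hf : ∀ i, Continuous fun q : T × Circle => f i q.1 q.2) :
    Continuous fun q : T × (Circle × Circle × Circle) => linkVec (fun i => f i q.1) q.2 := by
  have h₀ := (hf 0).comp
    (continuous_fst.prodMk (continuous_snd (Y := Circle × Circle × Circle)).fst)
  have h₁ := (hf 1).comp
    (continuous_fst.prodMk (continuous_snd (Y := Circle × Circle × Circle)).snd.fst)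
  have h₂ := (hf 2).comp
    (continuous_fst.prodMk (continuous_snd (Y := Circle × Circle × Circle)).snd.snd)
  refine continuous_pi fun i => ?_
  fin_cases i
  · exact h₀.sub h₁
  · exact h₁.sub h₂
  · exact h₂.sub h₀

theorem IsSpinorMap.exists_homotopic_linkVec [PreconnectedSpace T] [LocallyPathConnectedSpace T]
    {f : Fin 3 → T → Circle → E3} (hf : ∀ i, Continuous fun q : T × Circle => f i q.1 q.2)
    (hd : ∀ τ, DisjointImages fun i => f i τ) (τ τ' : T)
    {F : C(Circle × Circle × Circle, Punctured (ℂ × ℂ))}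
    (hF : IsSpinorMap (linkVec fun i => f i τ) F) :
    ∃ F', IsSpinorMap (linkVec fun i => f i τ') F' ∧ F.Homotopic F' :=
  IsSpinorMap.exists_homotopic (V := fun τ => linkVec fun i => f i τ) (continuous_linkVec hf)
    (fun τ => admissible_linkVec (hd τ)) τ τ' hF

theorem IsSpinorMap.exists_homotopic_const_of_isUnlink {f : Fin 3 → Circle → E3} (hf : IsUnlink f)
    {F : C(Circle × Circle × Circle, Punctured (ℂ × ℂ))} (hF : IsSpinorMap (linkVec f) F) :
    ∃ c, F.Homotopic (.const _ c) := by
  obtain ⟨D, hDs, -, -, hDf, hDd⟩ := hf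
  let shrink : Fin 3 → unitInterval → Circle → E3 := fun i τ z => D i (((τ : ℝ) : ℂ) * z)
  have hball (τ : unitInterval) (z : Circle) :
      ((τ : ℝ) : ℂ) * z ∈ Metric.closedBall (0 : ℂ) 1 := by
    simpa [abs_of_nonneg τ.2.1, Circle.norm_coe] using τ.2.2
  have hcont (i : Fin 3) : Continuous fun q : unitInterval × Circle => shrink i q.1 q.2 :=
    (hDs i).continuous.comp (by fun_prop)
  have hdisj (τ : unitInterval) : DisjointImages fun i => shrink i τ := fun i j hij =>
    (hDd hij).mono (range_subset_iff.2 fun z => mem_image_of_mem (D i) (hball τ z))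
      (range_subset_iff.2 fun z => mem_image_of_mem (D j) (hball τ z))
  obtain ⟨F', hF', hom⟩ := IsSpinorMap.exists_homotopic_linkVec hcont hdisj 1 0 (F := F)
    (by simpa [shrink, hDf] using hF)
  obtain ⟨c, hc⟩ := IsSpinorMap.exists_homotopic_const
    (admissible_linkVec (hdisj 0) 1) (F := F')
    (by convert hF' using 1; funext k; simp [shrink, linkVec])
  exact ⟨c, hom.trans hc⟩

theorem stdVec_one : stdVec 1 = linkVec borromean := by
  funext k i
  fin_cases i <;> ext j <;> fin_cases j <;>
    simp [stdVec, linkVec, borromean, f₁, f₂, f₃, one_add_one_eq_two, sub_eq_add_neg, add_comm]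

theorem exists_isSpinorMap_borromean_homotopic_stdMap :
    ∃ F, IsSpinorMap (linkVec borromean) F ∧ stdMap.Homotopic F := by
  obtain ⟨F, hF, hom⟩ := IsSpinorMap.exists_homotopic (T := unitInterval)
    (V := fun τ => stdVec τ) (continuous_stdVec.comp (by fun_prop :
      Continuous fun q : unitInterval × (Circle × Circle × Circle) => ((q.1 : ℝ), q.2)))
    (fun τ => admissible_stdVec τ.2.1) 0 1 (F := stdMap) isSpinorMap_stdMap
  exact ⟨F, stdVec_one ▸ hF, hom⟩

theorem not_linkHomotopic_of_isUnlink {f : Fin 3 → Circle → E3} (hf : IsUnlink f) :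
    ¬ LinkHomotopic borromean f := by
  rintro ⟨h, hcont, hdisj, h₀, h₁⟩
  obtain ⟨F, hF, hom⟩ := exists_isSpinorMap_borromean_homotopic_stdMap
  obtain ⟨F', hF', hom'⟩ := IsSpinorMap.exists_homotopic_linkVec hcont hdisj 0 1 (F := F)
    (by simpa only [h₀] using hF)
  simp only [h₁] at hF'
  obtain ⟨c, hom''⟩ := hF'.exists_homotopic_const_of_isUnlink hf
  exact not_homotopic_const_stdMap c ((hom.trans hom').trans hom'')

end LinkHomotopy

section Transversality

open Topology

variable {V W U : Type*} [NormedAddCommGroup V] [NormedSpace ℝ V] [NormedAddCommGroup W]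
  [NormedSpace ℝ W] [NormedAddCommGroup U] [NormedSpace ℝ U]

theorem map_sup_ker_eq_top_iff {R M N P : Type*} [Ring R] [AddCommGroup M] [Module R M]
    [AddCommGroup N] [Module R N] [AddCommGroup P] [Module R P] {D : Submodule R M}
    {A : M →ₗ[R] N} {L : N →ₗ[R] P} (hL : Function.Surjective L) :
    D.map A ⊔ LinearMap.ker L = ⊤ ↔ ∀ d, ∃ v ∈ D, L (A v) = d := by
  rw [← Submodule.comap_map_eq, ← Submodule.map_comp, Submodule.eq_top_iff']
  exact ⟨fun h d => by obtain ⟨w, rfl⟩ := hL d; exact h w, fun h w => h (L w)⟩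

theorem mem_stratumDirections_of_eventually {K : Set V} {p v : V}
    (h : ∀ᶠ r : ℝ in 𝓝 0, p + r • v ∈ K) : v ∈ stratumDirections K p := by
  obtain ⟨ε, hε, hK⟩ := Metric.eventually_nhds_iff.1 h
  exact Submodule.subset_span ⟨ε, hε, fun r hr => hK (by simpa using hr)⟩

theorem transverseOn_ker {K : Set V} {Φ : V → W} {L : W →L[ℝ] U}
    (hΦ : Differentiable ℝ Φ) (h : ∀ p ∈ K, L (Φ p) = 0 → ∀ d, ∃ v,
      (∀ᶠ r : ℝ in 𝓝 0, p + r • v ∈ K) ∧ HasLineDerivAt ℝ (fun q => L (Φ q)) d p v) :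
    TransverseOn K Φ (LinearMap.ker (L : W →ₗ[ℝ] U)) := by
  intro p hp hker
  have hderiv : HasFDerivAt (fun q => L (Φ q)) (L ∘L fderiv ℝ Φ p) p :=
    L.hasFDerivAt.comp p (hΦ p).hasFDerivAt
  have hsurj (d : U) : ∃ v ∈ stratumDirections K p, L (fderiv ℝ Φ p v) = d := by
    obtain ⟨v, hv, hd⟩ := h p hp hker d
    exact ⟨v, mem_stratumDirections_of_eventually hv, (hderiv.hasLineDerivAt v).unique hd⟩
  refine (map_sup_ker_eq_top_iff fun d => ?_).2 hsurj
  obtain ⟨v, -, hv⟩ := hsurj d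
  exact ⟨_, hv⟩

/-- The difference of two vectors, a linear map whose kernel is the diagonal. -/
def diffCLM : E3 × E3 →L[ℝ] E3 := ContinuousLinearMap.fst ℝ E3 E3 - ContinuousLinearMap.snd ℝ E3 E3

theorem ker_diffCLM : LinearMap.ker (diffCLM : E3 × E3 →ₗ[ℝ] E3) = diag :=
  (LinearMap.eqLocus_eq_ker_sub _ _).symm

theorem ker_prodMap_diffCLM :
    LinearMap.ker (diffCLM.prodMap diffCLM : (E3 × E3) × (E3 × E3) →ₗ[ℝ] E3 × E3) =
      diag.prod diag := by
  rw [← ker_diffCLM]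
  exact LinearMap.ker_prodMap _ _

theorem eventually_add_mul_mem_Icc {a b t : ℝ} (ht : t ∈ Ioo a b) (v : ℝ) :
    ∀ᶠ r : ℝ in 𝓝 0, t + r * v ∈ Icc a b := by
  have hc : ContinuousAt (fun r : ℝ => t + r * v) 0 := by fun_prop
  exact hc (by simpa using Icc_mem_nhds ht.1 ht.2)

theorem hasDerivAt_add_mul (a b : ℝ) : HasDerivAt (fun r : ℝ => a + r * b) b 0 := by
  simpa using ((hasDerivAt_id (0 : ℝ)).mul_const b).const_add a

theorem hasDerivAt_vec3 {a b c : ℝ → ℝ} {a' b' c' r : ℝ} (ha : HasDerivAt a a' r)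
    (hb : HasDerivAt b b' r) (hc : HasDerivAt c c' r) :
    HasDerivAt (fun r => (!₂[a r, b r, c r] : E3)) !₂[a', b', c'] r := by
  refine (PiLp.continuousLinearEquiv 2 ℝ fun _ : Fin 3 => ℝ).symm.hasFDerivAt.comp_hasDerivAt r
    (hasDerivAt_pi.2 fun i => ?_)
  fin_cases i
  exacts [ha, hb, hc]

theorem contDiff_vec3 {a b c : V → ℝ} (ha : ContDiff ℝ ∞ a) (hb : ContDiff ℝ ∞ b)
    (hc : ContDiff ℝ ∞ c) : ContDiff ℝ ∞ fun p => (!₂[a p, b p, c p] : E3) := by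
  rw [contDiff_euclidean]
  intro i
  fin_cases i
  exacts [ha, hb, hc]

theorem eq_vec3_iff {v : E3} {a b c : ℝ} : v = !₂[a, b, c] ↔ v 0 = a ∧ v 1 = b ∧ v 2 = c := by
  simp [PiLp.ext_iff, Fin.forall_fin_succ]

theorem vec3_eq_iff {a b c a' b' c' : ℝ} :
    (!₂[a, b, c] : E3) = !₂[a', b', c'] ↔ a = a' ∧ b = b' ∧ c = c' :=
  eq_vec3_iff

theorem vec3_sub (a b c a' b' c' : ℝ) :
    (!₂[a, b, c] : E3) - !₂[a', b', c'] = !₂[a - a', b - b', c - c'] :=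
  eq_vec3_iff.2 ⟨rfl, rfl, rfl⟩

end Transversality

section MapG

variable {V : Type*} [NormedAddCommGroup V] [NormedSpace ℝ V]

theorem re_circleExp (θ : ℝ) : (Circle.exp θ : ℂ).re = Real.cos θ := by
  rw [Circle.coe_exp, Complex.exp_ofReal_mul_I_re]

theorem im_circleExp (θ : ℝ) : (Circle.exp θ : ℂ).im = Real.sin θ := by
  rw [Circle.coe_exp, Complex.exp_ofReal_mul_I_im]

theorem circle_eq_of_re_eq_of_im_mul_im_nonneg {z w : Circle} (hre : (z : ℂ).re = (w : ℂ).re)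
    (him : 0 ≤ (z : ℂ).im * (w : ℂ).im) : z = w := by
  refine Circle.ext (Complex.ext hre ?_)
  have hz := circle_re_sq_add_im_sq z
  have hw := circle_re_sq_add_im_sq w
  rw [hre] at hz
  obtain h | h := sq_eq_sq_iff_eq_or_eq_neg.1 (by linarith : (z : ℂ).im ^ 2 = (w : ℂ).im ^ 2)
  · exact h
  · rw [h] at him ⊢
    nlinarith

theorem contDiff_f₁ {θ : V → ℝ} (hθ : ContDiff ℝ ∞ θ) :
    ContDiff ℝ ∞ fun p => f₁ (Circle.exp (θ p)) := by
  simp only [f₁, re_circleExp, im_circleExp]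
  exact contDiff_vec3 (by fun_prop) (by fun_prop) (by fun_prop)

theorem contDiff_f₃ {θ : V → ℝ} (hθ : ContDiff ℝ ∞ θ) :
    ContDiff ℝ ∞ fun p => f₃ (Circle.exp (θ p)) := by
  simp only [f₃, re_circleExp, im_circleExp]
  exact contDiff_vec3 (by fun_prop) (by fun_prop) (by fun_prop)

theorem contDiff_H₁ {θ t : V → ℝ} (hθ : ContDiff ℝ ∞ θ) (ht : ContDiff ℝ ∞ t) :
    ContDiff ℝ ∞ fun p => H₁ (Circle.exp (θ p)) (t p) := by
  simp only [H₁, re_circleExp, im_circleExp]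
  exact contDiff_vec3 (by fun_prop) (by fun_prop) (by fun_prop)

theorem G_eq (y z : Circle) (t s : ℝ) :
    G y z t s = (f₃ z, !₂[(y : ℂ).re, t, 2 * (y : ℂ).im + s * (4 * t - t ^ 2)]) := by
  refine Prod.ext rfl (eq_vec3_iff.2 ⟨?_, ?_, ?_⟩) <;> simp [G, H₁, H₃] <;> ring

theorem contDiff_G {y z t s : V → ℝ} (hy : ContDiff ℝ ∞ y) (hz : ContDiff ℝ ∞ z)
    (ht : ContDiff ℝ ∞ t) (hs : ContDiff ℝ ∞ s) :
    ContDiff ℝ ∞ fun p => G (Circle.exp (y p)) (Circle.exp (z p)) (t p) (s p) := by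
  simp only [G_eq, re_circleExp, im_circleExp]
  exact (contDiff_f₃ hz).prodMk (contDiff_vec3 (by fun_prop) (by fun_prop) (by fun_prop))

theorem hasDerivAt_f₁ {θ : ℝ → ℝ} {θ' r : ℝ} (hθ : HasDerivAt θ θ' r) :
    HasDerivAt (fun r => f₁ (Circle.exp (θ r)))
      !₂[0, 2 * (-Real.sin (θ r) * θ'), Real.cos (θ r) * θ'] r := by
  simp only [f₁, re_circleExp, im_circleExp]
  exact hasDerivAt_vec3 (hasDerivAt_const _ _) (hθ.cos.const_mul 2) hθ.sin

theorem hasDerivAt_f₃ {θ : ℝ → ℝ} {θ' r : ℝ} (hθ : HasDerivAt θ θ' r) :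
    HasDerivAt (fun r => f₃ (Circle.exp (θ r)))
      !₂[2 * (-Real.sin (θ r) * θ'), Real.cos (θ r) * θ', 0] r := by
  simp only [f₃, re_circleExp, im_circleExp]
  exact hasDerivAt_vec3 (hθ.cos.const_mul 2) hθ.sin (hasDerivAt_const _ _)

theorem hasDerivAt_G_snd {y t s : ℝ → ℝ} {y' t' s' r : ℝ} (z : ℝ → Circle)
    (hy : HasDerivAt y y' r) (ht : HasDerivAt t t' r) (hs : HasDerivAt s s' r) :
    HasDerivAt (fun r => (G (Circle.exp (y r)) (z r) (t r) (s r)).2)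
      !₂[-Real.sin (y r) * y', t', 2 * (Real.cos (y r) * y') +
        (s' * (4 * t r - t r ^ 2) + s r * (4 * t' - 2 * t r * t'))] r := by
  simp only [G_eq, re_circleExp, im_circleExp]
  refine hasDerivAt_vec3 hy.cos ht
    ((hy.sin.const_mul 2).fun_add (hs.fun_mul ((ht.const_mul 4).fun_sub ?_)))
  simpa using ht.fun_pow 2

theorem G_mem_diag {y z : Circle} {t s : ℝ} : G y z t s ∈ diag ↔
    2 * (z : ℂ).re = (y : ℂ).re ∧ (z : ℂ).im = t ∧ 0 = 2 * (y : ℂ).im + s * (4 * t - t ^ 2) := by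
  rw [G_eq]
  exact vec3_eq_iff

theorem three_quarters_le_sq_of_G_mem_diag {y z : Circle} {t s : ℝ} (h : G y z t s ∈ diag) :
    3 / 4 ≤ t ^ 2 := by
  obtain ⟨hre, rfl, -⟩ := G_mem_diag.1 h
  have hy := circle_re_sq_add_im_sq y
  rw [← hre] at hy
  linarith [circle_re_sq_add_im_sq z, sq_nonneg (y : ℂ).im]

theorem mem_Ioc_of_G_mem_diag {y z : Circle} {t s : ℝ} (ht : 0 ≤ t) (h : G y z t s ∈ diag) :
    t ∈ Ioc 0 1 := by
  have hsq := three_quarters_le_sq_of_G_mem_diag h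
  refine ⟨ht.lt_of_ne (by rintro rfl; norm_num at hsq), ?_⟩
  rw [← (G_mem_diag.1 h).2.1]
  exact (abs_le.1 (abs_im_le_one z)).2

theorem four_mul_sub_sq_pos {t : ℝ} (ht : t ∈ Ioc 0 1) : 0 < 4 * t - t ^ 2 := by
  nlinarith [ht.1, ht.2]

theorem im_nonpos_of_G_mem_diag {y z : Circle} {t s : ℝ} (ht : 0 ≤ t) (hs : 0 ≤ s)
    (h : G y z t s ∈ diag) : (y : ℂ).im ≤ 0 := by
  have hw := mul_nonneg hs (four_mul_sub_sq_pos (mem_Ioc_of_G_mem_diag ht h)).le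
  linarith [(G_mem_diag.1 h).2.2]

theorem lt_one_of_G_mem_diag {y z : Circle} {t s : ℝ} (ht : 0 ≤ t) (h : G y z t s ∈ diag) :
    s < 1 := by
  obtain ⟨ht₀, ht₁⟩ := mem_Ioc_of_G_mem_diag ht h
  have hsq := three_quarters_le_sq_of_G_mem_diag h
  by_contra! hs
  have hshift := le_mul_of_one_le_left (four_mul_sub_sq_pos ⟨ht₀, ht₁⟩).le hs
  have him : 3 * t ≤ -2 * (y : ℂ).im := by nlinarith [(G_mem_diag.1 h).2.2]
  nlinarith [(abs_le.1 (abs_im_le_one y)).1]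

theorem params_eq_of_G_mem_diag {y z : Circle} {t s t' s' : ℝ} (ht : 0 ≤ t)
    (h : G y z t s ∈ diag) (h' : G y z t' s' ∈ diag) : t = t' ∧ s = s' := by
  obtain ⟨-, rfl, h₂⟩ := G_mem_diag.1 h
  obtain ⟨-, rfl, h₂'⟩ := G_mem_diag.1 h'
  have hw := four_mul_sub_sq_pos (mem_Ioc_of_G_mem_diag ht h)
  exact ⟨rfl, mul_right_cancel₀ hw.ne' (by linarith)⟩

theorem injOn_fst_preimageG : InjOn (fun q => q.1) preimageG := by
  rintro ⟨y, z, t, s⟩ ⟨ht, -, h⟩ ⟨_, z', t', s'⟩ ⟨ht', -, h'⟩ rfl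
  dsimp only at ht ht' h h'
  obtain ⟨hre, him, -⟩ := G_mem_diag.1 h
  obtain ⟨hre', him', -⟩ := G_mem_diag.1 h'
  obtain rfl : z = z' := circle_eq_of_re_eq_of_im_mul_im_nonneg (by linarith)
    (by rw [him, him']; exact mul_nonneg ht.1 ht'.1)
  obtain ⟨rfl, rfl⟩ := params_eq_of_G_mem_diag ht.1 h h'
  rfl

theorem injOn_snd_preimageG : InjOn (fun q => q.2.1) preimageG := by
  rintro ⟨y, z, t, s⟩ ⟨ht, hs, h⟩ ⟨y', _, t', s'⟩ ⟨ht', hs', h'⟩ rfl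
  dsimp only at ht ht' hs hs' h h'
  obtain rfl : y = y' := circle_eq_of_re_eq_of_im_mul_im_nonneg
    ((G_mem_diag.1 h).1.symm.trans (G_mem_diag.1 h').1)
    (mul_nonneg_of_nonpos_of_nonpos (im_nonpos_of_G_mem_diag ht.1 hs.1 h)
      (im_nonpos_of_G_mem_diag ht'.1 hs'.1 h'))
  obtain ⟨rfl, rfl⟩ := params_eq_of_G_mem_diag ht.1 h h'
  rfl

end MapG

section Arc

open scoped Real

theorem hasLineDerivAt_diffCLM_G (y z t s vy vz vt vs : ℝ) :
    HasLineDerivAt ℝ (fun p : ℝ × ℝ × ℝ × ℝ =>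
      diffCLM (G (Circle.exp p.1) (Circle.exp p.2.1) p.2.2.1 p.2.2.2))
      !₂[-2 * Real.sin z * vz + Real.sin y * vy, Real.cos z * vz - vt,
        -2 * Real.cos y * vy - vs * (4 * t - t ^ 2) - s * (4 - 2 * t) * vt]
      (y, z, t, s) (vy, vz, vt, vs) := by
  have hderiv := (hasDerivAt_f₃ (hasDerivAt_add_mul z vz)).fun_sub
    (hasDerivAt_G_snd (fun r => Circle.exp (z + r * vz)) (hasDerivAt_add_mul y vy)
      (hasDerivAt_add_mul t vt) (hasDerivAt_add_mul s vs))
  refine hderiv.congr_deriv ?_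
  rw [vec3_sub, vec3_eq_iff]
  refine ⟨?_, ?_, ?_⟩ <;> ring_nf

theorem exists_hasLineDerivAt_diffCLM_G {y z t s : ℝ} (hz : Real.sin z ≠ 0)
    (hw : 4 * t - t ^ 2 ≠ 0) (hs : s = 0 → Real.sin y = 0) (d : E3) :
    ∃ vy vz vt vs : ℝ, (s = 0 → vs = 0) ∧ HasLineDerivAt ℝ (fun p : ℝ × ℝ × ℝ × ℝ =>
      diffCLM (G (Circle.exp p.1) (Circle.exp p.2.1) p.2.2.1 p.2.2.2)) d
      (y, z, t, s) (vy, vz, vt, vs) := by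
  suffices h : ∃ vy vz vt vs : ℝ, (s = 0 → vs = 0) ∧
      -2 * Real.sin z * vz + Real.sin y * vy = d 0 ∧ Real.cos z * vz - vt = d 1 ∧
      -2 * Real.cos y * vy - vs * (4 * t - t ^ 2) - s * (4 - 2 * t) * vt = d 2 by
    obtain ⟨vy, vz, vt, vs, hvs, h₀, h₁, h₂⟩ := h
    refine ⟨vy, vz, vt, vs, hvs, ?_⟩
    rw [eq_vec3_iff.2 ⟨h₀.symm, h₁.symm, h₂.symm⟩]
    exact hasLineDerivAt_diffCLM_G y z t s vy vz vt vs
  let vz := -d 0 / (2 * Real.sin z)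
  let vt := Real.cos z * vz - d 1
  have hvz : -2 * Real.sin z * vz = d 0 := by simp only [vz]; field_simp
  obtain hs₀ | hs₀ := eq_or_ne s 0
  · have hcos : Real.cos y ≠ 0 := fun hc => by
      simpa [hs hs₀, hc] using Real.sin_sq_add_cos_sq y
    refine ⟨-d 2 / (2 * Real.cos y), vz, vt, 0, fun _ => rfl, ?_, sub_sub_cancel _ _, ?_⟩
    · rw [hs hs₀, hvz, zero_mul, add_zero]
    · rw [hs₀]; field_simp; ring
  · refine ⟨0, vz, vt, -(d 2 + s * (4 - 2 * t) * vt) / (4 * t - t ^ 2), fun h => (hs₀ h).elim,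
      ?_, sub_sub_cancel _ _, ?_⟩
    · rw [hvz, mul_zero, add_zero]
    · rw [div_mul_cancel₀ _ hw]; ring

theorem transverseOn_G :
    TransverseOn {p : ℝ × ℝ × ℝ × ℝ | p.2.2.1 ∈ Set.Icc 0 4 ∧ p.2.2.2 ∈ Set.Icc 0 1}
      (fun p => G (Circle.exp p.1) (Circle.exp p.2.1) p.2.2.1 p.2.2.2) diag := by
  rw [← ker_diffCLM]
  refine transverseOn_ker ((contDiff_G (by fun_prop) (by fun_prop) (by fun_prop)
    (by fun_prop)).differentiable (by simp)) ?_
  rintro ⟨y, z, t, s⟩ ⟨ht, hs⟩ h d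
  dsimp only at ht hs h
  replace h : G (Circle.exp y) (Circle.exp z) t s ∈ diag := sub_eq_zero.1 h
  obtain ⟨ht₀, ht₁⟩ := mem_Ioc_of_G_mem_diag ht.1 h
  obtain ⟨-, him, hheight⟩ := G_mem_diag.1 h
  rw [im_circleExp] at him hheight
  have hsin (hs₀ : s = 0) : Real.sin y = 0 := by rw [hs₀] at hheight; linarith
  obtain ⟨vy, vz, vt, vs, hvs, hd⟩ := exists_hasLineDerivAt_diffCLM_G (him.trans_ne ht₀.ne')
    (four_mul_sub_sq_pos ⟨ht₀, ht₁⟩).ne' hsin d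
  refine ⟨(vy, vz, vt, vs), (eventually_add_mul_mem_Icc ⟨ht₀, by linarith⟩ vt).and ?_, hd⟩
  obtain hs₀ | hs₀ := hs.1.eq_or_lt
  · simpa [hvs hs₀.symm] using hs
  · exact eventually_add_mul_mem_Icc ⟨hs₀, lt_one_of_G_mem_diag ht.1 h⟩ vs

/-- The angle of the second circle along the preimage of the diagonal under `G`. -/
noncomputable def arcAngle (r : ℝ) : ℝ := Real.arccos (Real.cos (π * r) / 2)

theorem abs_cos_half_lt_one (θ : ℝ) : |Real.cos θ / 2| < 1 := by
  rw [abs_div, abs_two]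
  linarith [Real.abs_cos_le_one θ]

theorem cos_arcAngle (r : ℝ) : Real.cos (arcAngle r) = Real.cos (π * r) / 2 :=
  have h := abs_lt.1 (abs_cos_half_lt_one (π * r))
  Real.cos_arccos h.1.le h.2.le

theorem sin_arcAngle_mem_Icc (r : ℝ) : Real.sin (arcAngle r) ∈ Icc (3 / 4) 1 := by
  refine ⟨?_, Real.sin_le_one _⟩
  have hsq := Real.sin_sq_add_cos_sq (arcAngle r)
  rw [cos_arcAngle] at hsq
  have hpos : 0 ≤ Real.sin (arcAngle r) :=
    Real.sin_nonneg_of_nonneg_of_le_pi (Real.arccos_nonneg _) (Real.arccos_le_pi _)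
  nlinarith [Real.cos_sq_le_one (π * r)]

theorem two_le_four_mul_sin_arcAngle_sub_sq (r : ℝ) :
    2 ≤ 4 * Real.sin (arcAngle r) - Real.sin (arcAngle r) ^ 2 := by
  obtain ⟨h₀, h₁⟩ := sin_arcAngle_mem_Icc r
  nlinarith

theorem contDiff_arcAngle : ContDiff ℝ ∞ arcAngle := contDiff_iff_contDiffAt.2 fun r =>
  have h := abs_lt.1 (abs_cos_half_lt_one (π * r))
  (Real.contDiffAt_arccos h.1.ne' h.2.ne).comp r (by fun_prop)

/-- A parametrization by `[0, 1]` of the preimage of the diagonal under `G`, in angle coordinates.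
The first two equations `2 cos z = cos y` and `sin z = t` for a point of the preimage determine `z`
and `t` from `y`, the third one then determines `s`. -/
noncomputable def arc (r : ℝ) : ℝ × ℝ × ℝ × ℝ :=
  (-(π * r), arcAngle r, Real.sin (arcAngle r),
    2 * Real.sin (π * r) / (4 * Real.sin (arcAngle r) - Real.sin (arcAngle r) ^ 2))

theorem contDiff_arc : ContDiff ℝ ∞ arc := by
  have hangle := contDiff_arcAngle
  refine .prodMk (by fun_prop) (hangle.prodMk (hangle.sin.prodMk ?_))
  exact .div (by fun_prop) (by fun_prop) fun r => by
    linarith [two_le_four_mul_sin_arcAngle_sub_sq r]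

/-- The point of `S¹ × S¹ × ℝ × ℝ` with angle coordinates `arc r`. -/
noncomputable def arcPoint (r : ℝ) : Circle × Circle × ℝ × ℝ :=
  (Circle.exp (arc r).1, Circle.exp (arc r).2.1, (arc r).2.2)

theorem arcPoint_mem_preimageG {r : ℝ} (hr : r ∈ Icc 0 1) : arcPoint r ∈ preimageG := by
  obtain ⟨h₀, h₁⟩ := sin_arcAngle_mem_Icc r
  have hw := two_le_four_mul_sin_arcAngle_sub_sq r
  have hsin : 0 ≤ Real.sin (π * r) :=
    Real.sin_nonneg_of_nonneg_of_le_pi (mul_nonneg Real.pi_nonneg hr.1)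
      (mul_le_of_le_one_right Real.pi_nonneg hr.2)
  have hle := Real.sin_le_one (π * r)
  refine ⟨⟨by simp only [arcPoint, arc]; linarith, by simp only [arcPoint, arc]; linarith⟩,
    ⟨div_nonneg (by linarith) (by linarith), (div_le_one (by linarith)).2 (by linarith)⟩,
    G_mem_diag.2 ?_⟩
  simp only [arcPoint, arc, re_circleExp, im_circleExp, Real.cos_neg, Real.sin_neg, cos_arcAngle,
    true_and]
  exact ⟨by ring, by rw [div_mul_cancel₀ _ (by linarith)]; ring⟩

theorem exists_arcPoint_fst_eq {y : Circle} (hy : (y : ℂ).im ≤ 0) :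
    ∃ r ∈ Icc (0 : ℝ) 1, (arcPoint r).1 = y := by
  have harg : 0 ≤ Complex.arg (y⁻¹ : Circle) := by
    rw [Complex.arg_nonneg_iff, Circle.coe_inv_eq_conj, Complex.conj_im]
    linarith
  refine ⟨Complex.arg (y⁻¹ : Circle) / π, ⟨div_nonneg harg Real.pi_nonneg,
    (div_le_one Real.pi_pos).2 (Complex.arg_le_pi _)⟩, ?_⟩
  simp only [arcPoint, arc, mul_div_cancel₀ _ Real.pi_ne_zero, Circle.exp_neg, Circle.exp_arg,
    inv_inv]

theorem image_arcPoint : arcPoint '' Icc 0 1 = preimageG := by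
  refine Subset.antisymm (image_subset_iff.2 fun r hr => arcPoint_mem_preimageG hr) fun q hq => ?_
  obtain ⟨r, hr, hfst⟩ :=
    exists_arcPoint_fst_eq (im_nonpos_of_G_mem_diag hq.1.1 hq.2.1.1 hq.2.2)
  exact ⟨r, hr, injOn_fst_preimageG (arcPoint_mem_preimageG hr) hq hfst⟩

theorem injOn_arcPoint : InjOn arcPoint (Icc 0 1) := by
  intro r hr r' hr' h
  have hmem {r : ℝ} (hr : r ∈ Icc 0 1) : -(π * r) ∈ Icc (-π) 0 := by
    constructor <;> nlinarith [Real.pi_pos, hr.1, hr.2]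
  have hangle := Circle.exp_injOn_Icc (by linarith [Real.pi_pos]) (hmem hr) (hmem hr')
    (congrArg Prod.fst h)
  exact mul_left_cancel₀ Real.pi_ne_zero (neg_injective hangle)

theorem isSmoothArc_preimageG : IsSmoothArc preimageG := by
  refine ⟨arc, contDiff_arc, fun r _ h => ?_, injOn_arcPoint, image_arcPoint⟩
  have harc : HasDerivAt arc (deriv arc r) r :=
    (contDiff_arc.differentiable (by simp) r).hasDerivAt
  have hfst : HasDerivAt (fun r => -(π * r)) (deriv arc r).1 r :=
    (ContinuousLinearMap.fst ℝ ℝ (ℝ × ℝ × ℝ)).hasFDerivAt.comp_hasDerivAt r harc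
  rw [h] at hfst
  simpa using hfst.unique ((hasDerivAt_id r).const_mul π).neg

theorem isCompact_preimageG : IsCompact preimageG := by
  rw [← image_arcPoint]
  have harc := contDiff_arc.continuous
  exact isCompact_Icc.image (((map_continuous Circle.exp).comp harc.fst).prodMk
    (((map_continuous Circle.exp).comp harc.snd.fst).prodMk harc.snd.snd))

theorem isEmbedding_restrict_of_isCompact {X Y : Type*} [TopologicalSpace X] [TopologicalSpace Y]
    [T2Space Y] {K : Set X} (hK : IsCompact K) {f : X → Y} (hf : Continuous f) (hinj : InjOn f K) :
    Topology.IsEmbedding fun x : K => f x :=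
  have := isCompact_iff_compactSpace.1 hK
  ((hf.comp continuous_subtype_val).isClosedEmbedding hinj.injective).isEmbedding

theorem isEmbedding_fst_preimageG : Topology.IsEmbedding fun q : preimageG => q.1.1 :=
  isEmbedding_restrict_of_isCompact isCompact_preimageG continuous_fst injOn_fst_preimageG

theorem isEmbedding_snd_preimageG : Topology.IsEmbedding fun q : preimageG => q.1.2.1 :=
  isEmbedding_restrict_of_isCompact isCompact_preimageG (by fun_prop) injOn_snd_preimageG

end Arc

section Links

theorem pairwise_fin_three {r : Fin 3 → Fin 3 → Prop} (hr : ∀ ⦃i j⦄, r i j → r j i)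
    (h₀₁ : r 0 1) (h₁₂ : r 1 2) (h₀₂ : r 0 2) : Pairwise r := by
  intro i j hij
  fin_cases i <;> fin_cases j
  exacts [(hij rfl).elim, h₀₁, h₀₂, hr h₀₁, (hij rfl).elim, h₁₂, hr h₀₂, hr h₁₂, (hij rfl).elim]

theorem disjointImages_of_ne {f : Fin 3 → Circle → E3} (h₀₁ : ∀ x y, f 0 x ≠ f 1 y)
    (h₁₂ : ∀ y z, f 1 y ≠ f 2 z) (h₀₂ : ∀ x z, f 0 x ≠ f 2 z) : DisjointImages f := by
  have disjoint_ranges {i j : Fin 3} (h : ∀ x y, f i x ≠ f j y) :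
      Disjoint (range (f i)) (range (f j)) := by
    rw [disjoint_range_iff]
    exact h
  exact pairwise_fin_three (fun _ _ h => h.symm) (disjoint_ranges h₀₁) (disjoint_ranges h₁₂)
    (disjoint_ranges h₀₂)

theorem f₁_ne_H₁ (x y : Circle) (t : ℝ) : f₁ x ≠ H₁ y t := by
  intro h
  obtain ⟨h₀, -, h₂⟩ := vec3_eq_iff.1 h
  have hx := circle_re_sq_add_im_sq x
  have hy := circle_re_sq_add_im_sq y
  rw [h₂] at hx
  rw [← h₀] at hy
  linarith [sq_nonneg (x : ℂ).re]

theorem f₁_ne_f₃ (x z : Circle) : f₁ x ≠ f₃ z := by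
  intro h
  obtain ⟨-, h₁, h₂⟩ := vec3_eq_iff.1 h
  have hx := circle_re_sq_add_im_sq x
  have hz := circle_re_sq_add_im_sq z
  rw [h₂] at hx
  rw [← h₁] at hz
  linarith [sq_nonneg (z : ℂ).re]

theorem f₂_ne_f₃ (y z : Circle) : f₂ y ≠ f₃ z := by
  intro h
  obtain ⟨h₀, h₁, h₂⟩ := vec3_eq_iff.1 h
  have hy := circle_re_sq_add_im_sq y
  have hz := circle_re_sq_add_im_sq z
  rw [h₀, (mul_eq_zero.1 h₂).resolve_left two_ne_zero] at hy
  rw [← h₁] at hz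
  linarith

theorem e₂_ne_f₃ (y z : Circle) : e₂ y ≠ f₃ z := by
  intro h
  linarith [(vec3_eq_iff.1 h).2.1, (abs_le.1 (abs_im_le_one z)).2]

theorem isLinkMap_borromean : IsLinkMap borromean := by
  refine ⟨fun i => ?_, disjointImages_of_ne (fun x y => f₁_ne_H₁ x y 0) f₂_ne_f₃ f₁_ne_f₃⟩
  fin_cases i
  exacts [contDiff_f₁ contDiff_id, contDiff_H₁ (t := fun _ => 0) contDiff_id contDiff_const,
    contDiff_f₃ contDiff_id]

theorem isLinkMap_unlink : IsLinkMap unlink := by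
  refine ⟨fun i => ?_, disjointImages_of_ne (fun x y => f₁_ne_H₁ x y 4) e₂_ne_f₃ f₁_ne_f₃⟩
  fin_cases i
  exacts [contDiff_f₁ contDiff_id, contDiff_H₁ (t := fun _ => 4) contDiff_id contDiff_const,
    contDiff_f₃ contDiff_id]

/-- Disks bounded by the components of `unlink`. The flat disk bounded by the first component meets
the third component, so the first disk is a paraboloid around it. -/
noncomputable def unlinkDisk : Fin 3 → ℂ → E3 :=
  ![fun w => !₂[4 * (1 - (w.re ^ 2 + w.im ^ 2)), 2 * w.re, w.im],
    fun w => !₂[w.re, 4, 2 * w.im],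
    fun w => !₂[2 * w.re, w.im, 0]]

theorem contDiff_unlinkDisk (i : Fin 3) : ContDiff ℝ ∞ (unlinkDisk i) := by
  have hre : ContDiff ℝ ∞ Complex.re := Complex.reCLM.contDiff
  have him : ContDiff ℝ ∞ Complex.im := Complex.imCLM.contDiff
  fin_cases i <;> exact contDiff_vec3 (by fun_prop) (by fun_prop) (by fun_prop)

theorem unlinkDisk_circle (i : Fin 3) (z : Circle) : unlinkDisk i z = unlink i z := by
  fin_cases i
  · refine vec3_eq_iff.2 ⟨?_, rfl, rfl⟩
    rw [circle_re_sq_add_im_sq, sub_self, mul_zero]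
  · rfl
  · rfl

theorem exists_leftInverse_unlinkDisk (i : Fin 3) :
    ∃ L : E3 →L[ℝ] ℂ, Function.LeftInverse L (unlinkDisk i) := by
  let coord (j : Fin 3) : E3 →L[ℝ] ℝ := EuclideanSpace.proj j
  let toComplex (a b : E3 →L[ℝ] ℝ) : E3 →L[ℝ] ℂ :=
    Complex.equivRealProdCLM.symm.toContinuousLinearMap ∘L a.prod b
  have half_mul (a : ℝ) : (1 / 2 : ℝ) * (2 * a) = a := by ring
  fin_cases i
  · exact ⟨toComplex ((1 / 2 : ℝ) • coord 1) (coord 2), fun w => Complex.ext (half_mul _) rfl⟩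
  · exact ⟨toComplex (coord 0) ((1 / 2 : ℝ) • coord 2), fun w => Complex.ext rfl (half_mul _)⟩
  · exact ⟨toComplex ((1 / 2 : ℝ) • coord 0) (coord 1), fun w => Complex.ext (half_mul _) rfl⟩

theorem injective_fderiv_of_leftInverse {V W : Type*} [NormedAddCommGroup V] [NormedSpace ℝ V]
    [NormedAddCommGroup W] [NormedSpace ℝ W] {f : V → W} {L : W →L[ℝ] V}
    (hL : Function.LeftInverse L f) {v : V} (hf : DifferentiableAt ℝ f v) :
    Function.Injective (fderiv ℝ f v) := by
  have hcomp : HasFDerivAt (L ∘ f) (L ∘L fderiv ℝ f v) v := L.hasFDerivAt.comp v hf.hasFDerivAt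
  rw [hL.comp_eq_id] at hcomp
  exact Function.LeftInverse.injective
    (DFunLike.congr_fun (hcomp.unique (hasFDerivAt_id v)))

theorem re_sq_add_im_sq_le_one {w : ℂ} (hw : w ∈ Metric.closedBall 0 1) :
    w.re ^ 2 + w.im ^ 2 ≤ 1 := by
  rw [mem_closedBall_zero_iff] at hw
  rw [sq, sq, ← Complex.normSq_apply, ← Complex.sq_norm]
  exact pow_le_one₀ (norm_nonneg w) hw

theorem pairwise_disjoint_unlinkDisk : Pairwise fun i j =>
    Disjoint (unlinkDisk i '' Metric.closedBall 0 1) (unlinkDisk j '' Metric.closedBall 0 1) := by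
  have disjoint_disks {i j : Fin 3} (h : ∀ w w' : ℂ, w.re ^ 2 + w.im ^ 2 ≤ 1 →
      w'.re ^ 2 + w'.im ^ 2 ≤ 1 → unlinkDisk i w ≠ unlinkDisk j w') :
      Disjoint (unlinkDisk i '' Metric.closedBall 0 1)
        (unlinkDisk j '' Metric.closedBall 0 1) := by
    refine disjoint_image_image
      fun w hw w' hw' => h w w' (re_sq_add_im_sq_le_one hw) (re_sq_add_im_sq_le_one hw')
  refine pairwise_fin_three (fun _ _ h => h.symm) (disjoint_disks fun w w' hw _ h => ?_)
    (disjoint_disks fun w w' _ hw' h => ?_) (disjoint_disks fun w w' _ hw' h => ?_)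
  · obtain ⟨-, h₁, -⟩ := vec3_eq_iff.1 h
    nlinarith [sq_nonneg w.im]
  · obtain ⟨-, h₁, -⟩ := vec3_eq_iff.1 h
    nlinarith [sq_nonneg w'.re]
  · obtain ⟨h₀, h₁, h₂⟩ := vec3_eq_iff.1 h
    have hre : w'.re = 2 * (1 - w.re ^ 2) := by rw [h₂] at h₀; linarith
    rw [hre, ← h₁] at hw'
    nlinarith [sq_nonneg (w.re ^ 2 - 1 / 2)]

theorem isUnlink_unlink : IsUnlink unlink := by
  refine ⟨unlinkDisk, contDiff_unlinkDisk, fun i => ?_, fun i w _ => ?_, unlinkDisk_circle,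
    pairwise_disjoint_unlinkDisk⟩ <;> obtain ⟨L, hL⟩ := exists_leftInverse_unlinkDisk i
  · exact hL.injective.injOn
  · exact injective_fderiv_of_leftInverse hL ((contDiff_unlinkDisk i).differentiable (by simp) w)

end Links

section StagePath

theorem isStagePath_liftedPath : IsStagePath 4 liftedPath := by
  refine ⟨fun i => ?_, fun h => ?_, fun h x y u _ => ?_, fun h x y u hu => ?_⟩
  · fin_cases i
    exacts [contDiff_f₁ contDiff_fst, contDiff_H₁ contDiff_fst contDiff_snd,
      contDiff_f₃ contDiff_fst]
  · fin_cases h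
    · exact (contDiff_f₁ (by fun_prop)).prodMk (contDiff_f₃ (by fun_prop))
    · exact (contDiff_H₁ (by fun_prop) (by fun_prop)).prodMk (contDiff_f₁ (by fun_prop))
    · exact contDiff_G (by fun_prop) (by fun_prop) (by fun_prop) (by fun_prop)
  · fin_cases h
    · rfl
    · rfl
    · change G y x u 0 = (f₃ x, H₁ y u)
      simp [G]
  · fin_cases h
    · exact f₁_ne_f₃ x y
    · exact (f₁_ne_H₁ y x u).symm
    · exact fun hd => (lt_one_of_G_mem_diag hu.1 hd).false

theorem G_zero (y z : Circle) (s : ℝ) : G y z 0 s = (f₃ z, f₂ y) := by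
  simp [G_eq, f₂]

theorem G_four (y z : Circle) (s : ℝ) : G y z 4 s = (f₃ z, e₂ y) := by
  norm_num [G_eq, e₂]

theorem atLinkMap_borromean : AtLinkMap liftedPath 0 borromean := by
  refine ⟨fun i x => ?_, fun h x y s _ => ?_⟩
  · fin_cases i <;> rfl
  · fin_cases h
    exacts [rfl, rfl, G_zero y x s]

theorem atLinkMap_unlink : AtLinkMap liftedPath 4 unlink := by
  refine ⟨fun i x => ?_, fun h x y s _ => ?_⟩
  · fin_cases i <;> rfl
  · fin_cases h
    exacts [rfl, rfl, G_four y x s]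

end StagePath

section Obstruction

open Topology
open scoped Real

theorem eq_disk₂_of_pieceMap_mem {k : Piece} {p : Param}
    (h : pieceMap liftedPath k p ∈ diag.prod diag) : k = .disk₂ 2 := by
  obtain ⟨x, s, t, u⟩ := p
  cases k with
  | circles i =>
    fin_cases i
    exacts [(f₁_ne_f₃ (x 0) (x 2) h.1).elim, ((f₁_ne_H₁ (x 0) (x 1) u).symm h.1).elim,
      ((f₁_ne_H₁ (x 0) (x 1) u).symm h.2).elim]
  | disk₁ i =>
    fin_cases i
    exacts [(f₁_ne_f₃ (x 0) (x 2) h.2).elim, ((f₁_ne_H₁ (x 0) (x 1) u).symm h.2).elim,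
      (f₁_ne_f₃ (x 0) (x 2) h.1).elim]
  | disk₂ i =>
    fin_cases i
    exacts [(f₁_ne_f₃ (x 0) (x 2) h.1).elim, ((f₁_ne_H₁ (x 0) (x 1) u).symm h.1).elim, rfl]

theorem pieceMap_disk₂_mem_iff {x : Fin 3 → Circle} {s t u : ℝ} :
    pieceMap liftedPath (.disk₂ 2) (x, s, t, u) ∈ diag.prod diag ↔
      (2 * (x 2 : ℂ).re = (x 1 : ℂ).re ∧ (x 2 : ℂ).im = u ∧
        0 = 2 * (x 1 : ℂ).im + s * (4 * u - u ^ 2)) ∧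
      (x 1 : ℂ).re = 0 ∧ u = 2 * (x 0 : ℂ).re ∧
        2 * (x 1 : ℂ).im + t * (4 * u - u ^ 2) = (x 0 : ℂ).im := by
  refine and_congr G_mem_diag ?_
  change (G (x 1) (x 2) u t).2 = f₁ (x 0) ↔ _
  rw [G_eq]
  exact vec3_eq_iff

/-- The angles of the point of the obstruction manifold. -/
noncomputable def obstructionAngle : Fin 3 → ℝ := ![-(π / 3), -(π / 2), π / 2]

/-- The point of the obstruction manifold, in the parameters `(x, s, t, u)` of its pieces. -/
noncomputable def obstructionPoint : Param :=
  (fun i => Circle.exp (obstructionAngle i), 2 / 3, (2 - √3 / 2) / 3, 1)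

theorem cos_obstructionAngle (i : Fin 3) : Real.cos (obstructionAngle i) = ![1 / 2, 0, 0] i := by
  fin_cases i <;> simp [obstructionAngle]

theorem sin_obstructionAngle (i : Fin 3) :
    Real.sin (obstructionAngle i) = ![-(√3 / 2), -1, 1] i := by
  fin_cases i <;> simp [obstructionAngle]

theorem sqrt_three_mem_Ioo : √3 ∈ Ioo 0 2 :=
  ⟨by positivity, by rw [Real.sqrt_lt' two_pos]; norm_num⟩

theorem obstructionPoint_mem_pieceSet : obstructionPoint ∈ pieceSet 4 liftedPath (.disk₂ 2) := by
  obtain ⟨h₀, h₁⟩ := sqrt_three_mem_Ioo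
  refine ⟨⟨⟨?_, ?_, ?_⟩, ?_⟩, pieceMap_disk₂_mem_iff.2 ?_⟩ <;>
    simp only [obstructionPoint, re_circleExp, im_circleExp, cos_obstructionAngle,
      sin_obstructionAngle, Matrix.cons_val]
  · linarith
  · linarith
  · norm_num
  · norm_num
  · exact ⟨by norm_num, trivial, by norm_num, by ring⟩

theorem eq_obstructionPoint_of_mem {p : Param} (hp : p ∈ pieceSet 4 liftedPath (.disk₂ 2)) :
    p = obstructionPoint := by
  obtain ⟨x, s, t, u⟩ := p
  obtain ⟨⟨⟨ht, hts, hs⟩, hu, -⟩, hmem⟩ := hp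
  dsimp only at ht hts hs hu
  obtain ⟨⟨hre₂, him₂, hheight⟩, hre₁, hre₀, him₀⟩ := pieceMap_disk₂_mem_iff.1 hmem
  have hcircle {i : Fin 3} (hre : (x i : ℂ).re = ![1 / 2, 0, 0] i)
      (him : 0 ≤ (x i : ℂ).im * ![-(√3 / 2), -1, 1] i) :
      x i = Circle.exp (obstructionAngle i) :=
    circle_eq_of_re_eq_of_im_mul_im_nonneg
      (by rw [hre, re_circleExp, cos_obstructionAngle])
      (by rwa [im_circleExp, sin_obstructionAngle])
  have him_eq {i : Fin 3} (h : x i = Circle.exp (obstructionAngle i)) :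
      (x i : ℂ).im = ![-(√3 / 2), -1, 1] i := by
    rw [h, im_circleExp, sin_obstructionAngle]
  have hx₂ : x 2 = Circle.exp (obstructionAngle 2) := hcircle
    (by simp only [Matrix.cons_val]; linarith) (by simp only [Matrix.cons_val]; linarith)
  obtain rfl : u = 1 := him₂.symm.trans (him_eq hx₂)
  have hx₁ : x 1 = Circle.exp (obstructionAngle 1) := hcircle hre₁
    (by simp only [Matrix.cons_val]; linarith)
  have him₁ : (x 1 : ℂ).im = -1 := him_eq hx₁
  obtain rfl : s = 2 / 3 := by linarith
  have hx₀ : x 0 = Circle.exp (obstructionAngle 0) := hcircle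
    (by simp only [Matrix.cons_val]; linarith)
    (mul_nonneg_of_nonpos_of_nonpos (by linarith)
      (neg_nonpos.2 (by positivity : 0 ≤ √3 / 2)))
  have him₀' : (x 0 : ℂ).im = -(√3 / 2) := him_eq hx₀
  obtain rfl : t = (2 - √3 / 2) / 3 := by linarith
  refine Prod.ext (funext fun i => ?_) rfl
  fin_cases i
  exacts [hx₀, hx₁, hx₂]

theorem nonempty_unique_obstructionManifold :
    Nonempty (Unique (ObstructionManifold 4 liftedPath)) := by
  refine ⟨⟨⟨Quot.mk _ ⟨_, _, obstructionPoint_mem_pieceSet⟩⟩, Quot.ind ?_⟩⟩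
  rintro ⟨k, p, hp⟩
  obtain rfl := eq_disk₂_of_pieceMap_mem hp.2
  obtain rfl := eq_obstructionPoint_of_mem hp
  rfl

theorem hasLineDerivAt_diffCLM_pieceMap {θ : Fin 3 → ℝ}
    (hθ : ∀ i, Circle.exp (θ i) = Circle.exp (obstructionAngle i)) (v₀ v₁ v₂ vs vt vu : ℝ) :
    HasLineDerivAt ℝ (fun p : (Fin 3 → ℝ) × ℝ × ℝ × ℝ => diffCLM.prodMap diffCLM
        (pieceMap liftedPath (.disk₂ 2) (fun i => Circle.exp (p.1 i), p.2)))
      (!₂[-2 * v₂ - v₁, -vu, -3 * vs - 4 / 3 * vu],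
        !₂[v₁, vu - √3 * v₀, 3 * vt + 2 * obstructionPoint.2.2.1 * vu - v₀ / 2])
      (θ, obstructionPoint.2) (![v₀, v₁, v₂], vs, vt, vu) := by
  have hcos (i : Fin 3) : Real.cos (θ i) = ![1 / 2, 0, 0] i := by
    rw [← re_circleExp, hθ, re_circleExp, cos_obstructionAngle]
  have hsin (i : Fin 3) : Real.sin (θ i) = ![-(√3 / 2), -1, 1] i := by
    rw [← im_circleExp, hθ, im_circleExp, sin_obstructionAngle]
  have hG := hasLineDerivAt_diffCLM_G (θ 1) (θ 2) 1 (2 / 3) v₁ v₂ vu vs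
  have hf := (hasDerivAt_G_snd (fun r => Circle.exp (θ 2 + r * v₂)) (hasDerivAt_add_mul (θ 1) v₁)
    (hasDerivAt_add_mul 1 vu) (hasDerivAt_add_mul obstructionPoint.2.2.1 vt)).fun_sub
      (hasDerivAt_f₁ (hasDerivAt_add_mul (θ 0) v₀))
  refine (HasDerivAt.prodMk hG hf).congr_deriv (Prod.ext ?_ ?_)
  · simp only [vec3_eq_iff, hcos, hsin, Matrix.cons_val]
    refine ⟨?_, ?_, ?_⟩ <;> ring
  · simp only [vec3_sub, vec3_eq_iff, zero_mul, add_zero, hcos, hsin, Matrix.cons_val]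
    refine ⟨?_, ?_, ?_⟩ <;> ring

theorem exists_hasLineDerivAt_diffCLM_pieceMap {θ : Fin 3 → ℝ}
    (hθ : ∀ i, Circle.exp (θ i) = Circle.exp (obstructionAngle i)) (w : E3 × E3) :
    ∃ v, HasLineDerivAt ℝ (fun p : (Fin 3 → ℝ) × ℝ × ℝ × ℝ => diffCLM.prodMap diffCLM
        (pieceMap liftedPath (.disk₂ 2) (fun i => Circle.exp (p.1 i), p.2)))
      w (θ, obstructionPoint.2) v := by
  obtain ⟨d, e⟩ := w
  let v₀ := -(e 1 + d 1) / √3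
  have hv₀ : √3 * v₀ = -(e 1 + d 1) := mul_div_cancel₀ _ sqrt_three_mem_Ioo.1.ne'
  refine ⟨_, (hasLineDerivAt_diffCLM_pieceMap hθ v₀ (e 0) (-(d 0 + e 0) / 2)
    ((4 / 3 * d 1 - d 2) / 3) ((e 2 + 2 * obstructionPoint.2.2.1 * d 1 + v₀ / 2) / 3)
    (-d 1)).congr_deriv (Prod.ext ?_ ?_)⟩ <;> symm
  · refine eq_vec3_iff.2 ⟨?_, ?_, ?_⟩ <;> ring
  · exact eq_vec3_iff.2 ⟨rfl, by rw [hv₀]; ring, by ring⟩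

theorem eventually_add_smul_mem_paramDomain (v : ℝ × ℝ × ℝ) :
    ∀ᶠ r : ℝ in 𝓝 0, obstructionPoint.2 + r • v ∈ paramDomain 4 (.disk₂ 2) := by
  obtain ⟨h₀, h₁⟩ := sqrt_three_mem_Ioo
  obtain ⟨vs, vt, vu⟩ := v
  have ht := eventually_add_mul_mem_Icc (a := 0) (b := 1) (t := (2 - √3 / 2) / 3)
    ⟨by linarith, by linarith⟩ vt
  have hs := eventually_add_mul_mem_Icc (a := 0) (b := 1) (t := 2 / 3)
    ⟨by norm_num, by norm_num⟩ vs
  have hts := eventually_add_mul_mem_Icc (a := 0) (b := 1) (t := 2 / 3 - (2 - √3 / 2) / 3)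
    ⟨by linarith, by linarith⟩ (vs - vt)
  have hu := eventually_add_mul_mem_Icc (a := 0) (b := 4) (t := 1)
    ⟨by norm_num, by norm_num⟩ vu
  filter_upwards [ht, hs, hts, hu] with r ht hs hts hu
  refine ⟨⟨ht.1, ?_, hs.2⟩, hu⟩
  change (2 - √3 / 2) / 3 + r * vt ≤ 2 / 3 + r * vs
  linarith [hts.1]

theorem contDiff_pieceMap_disk₂ : ContDiff ℝ ∞ fun p : (Fin 3 → ℝ) × ℝ × ℝ × ℝ =>
    pieceMap liftedPath (.disk₂ 2) (fun i => Circle.exp (p.1 i), p.2) :=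
  (contDiff_G (by fun_prop) (by fun_prop) (by fun_prop) (by fun_prop)).prodMk
    ((contDiff_G (by fun_prop) (z := fun p => p.1 2) (by fun_prop) (by fun_prop)
      (by fun_prop)).snd.prodMk (contDiff_f₁ (by fun_prop)))

theorem transverseOn_pieceMap_disk₂ :
    TransverseOn {p : (Fin 3 → ℝ) × ℝ × ℝ × ℝ | p.2 ∈ paramDomain 4 (.disk₂ 2)}
      (fun p => pieceMap liftedPath (.disk₂ 2) (fun i => Circle.exp (p.1 i), p.2))
      (diag.prod diag) := by
  rw [← ker_prodMap_diffCLM]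
  refine transverseOn_ker (contDiff_pieceMap_disk₂.differentiable (by simp)) ?_
  rintro ⟨θ, q⟩ hq hker w
  have hmem : ((fun i => Circle.exp (θ i), q) : Param) ∈ pieceSet 4 liftedPath (.disk₂ 2) :=
    ⟨hq, by rw [← ker_prodMap_diffCLM]; exact hker⟩
  obtain ⟨hθ, rfl⟩ := Prod.ext_iff.1 (eq_obstructionPoint_of_mem hmem)
  obtain ⟨v, hv⟩ := exists_hasLineDerivAt_diffCLM_pieceMap (congrFun hθ) w
  exact ⟨v, eventually_add_smul_mem_paramDomain v.2, hv⟩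

theorem isTransversePath_liftedPath : IsTransversePath 4 liftedPath := by
  intro k p hp h
  obtain rfl := eq_disk₂_of_pieceMap_mem h
  exact transverseOn_pieceMap_disk₂ p hp h

end Obstruction

end BorromeanRings

theorem mainTheorem6 :
    (TransverseOn {p : ℝ × ℝ × ℝ × ℝ | p.2.2.1 ∈ Set.Icc 0 4 ∧ p.2.2.2 ∈ Set.Icc 0 1}
        (fun p => G (Circle.exp p.1) (Circle.exp p.2.1) p.2.2.1 p.2.2.2) diag ∧
      IsSmoothArc preimageG ∧
      Topology.IsEmbedding (fun q : preimageG => q.1.1) ∧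
      Topology.IsEmbedding (fun q : preimageG => q.1.2.1)) ∧
    (IsLinkMap borromean ∧ IsLinkMap unlink ∧ IsUnlink unlink ∧
      IsStagePath 4 liftedPath ∧
      AtLinkMap liftedPath 0 borromean ∧ AtLinkMap liftedPath 4 unlink ∧
      IsTransversePath 4 liftedPath ∧
      Nonempty (Unique (ObstructionManifold 4 liftedPath))) ∧
    (¬ LinkHomotopic borromean unlink ∧
      ∀ V : Fin 3 → Circle → E3, IsUnlink V → ¬ LinkHomotopic borromean V) :=
  ⟨⟨transverseOn_G, isSmoothArc_preimageG, isEmbedding_fst_preimageG, isEmbedding_snd_preimageG⟩,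
    ⟨isLinkMap_borromean, isLinkMap_unlink, isUnlink_unlink, isStagePath_liftedPath,
      atLinkMap_borromean, atLinkMap_unlink, isTransversePath_liftedPath,
      nonempty_unique_obstructionManifold⟩,
    ⟨not_linkHomotopic_of_isUnlink isUnlink_unlink,
      fun _ hV => not_linkHomotopic_of_isUnlink hV⟩⟩
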